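/- Let $p$ be an odd prime, $m\ge 1$ an integer, $\mathbb{F}_{p^m}$ the field with $p^m$ elements and $\mathrm{Tr}$ the absolute trace from $\mathbb{F}_{p^m}$ to $\mathbb{F}_p$. Let $f:\mathbb{F}_{p^m}\to\mathbb{F}_{p^m}$ be a PN-DO function, that is: - $f$ is perfect nonlinear: $\max_{a\ne 0}\max_{b}|\{x\in\mathbb{F}_{p^m}: f(x+a)-f(x)=b\}|=1$; - $f$ has algebraic degree $2$: in the unique polynomial of degree less than $p^m$ representing $f$, the largest base-$p$ digit sum of the exponent of an occurring monomial is $2$. An $[n,k,d]$ code over $\mathbb{F}_p$ is a $k$-dimensional subspace of $\mathbb{F}_p^n$ with minimum Hamming distance $d$; it is distance-optimal if there is no $[n,k,d+1]$ code over $\mathbb{F}_p$, and distance-optimal with respect to a given upper bound on the number of codewords if moreover that bound, taken at length $n$ and distance $d+1$, is smaller than $p^k$. Let $$\bar{\mathcal C}_f=\left\{\big(\mathrm{Tr}(af(x)+bx)+c\big)_{x\in\mathbb{F}_{p^m}} : a,b\in\mathbb{F}_{p^m},\ c\in\mathbb{F}_p\right\}$$ and let $\bar{\mathcal C}_f^{\perp}$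 be its dual code with respect to the standard inner product. Then the following hold; in the weight distributions, the multiplicities of rows with equal weights are added (rows coincide only for $m=1$), and weights not listed do not occur. (1) If $m$ is odd, then $\bar{\mathcal C}_f$ is a $[p^m,\,2m+1,\,(p-1)p^{m-1}-p^{\frac{m-1}{2}}]$ code with weight distribution: weight $0$ occurs $1$ time; weight $(p-1)p^{m-1}$ occurs $(p^m-1)(p^{m-1}+1)p$ times; each of the weights $(p-1)p^{m-1}+p^{\frac{m-1}{2}}$ and $(p-1)p^{m-1}-p^{\frac{m-1}{2}}$ occurs $\frac12(p^m-1)p^m(p-1)$ times; weight $p^m$ occurs $p-1$ times. (2) If $m$ is even, then $\bar{\mathcal C}_f$ is a $[p^m,\,2m+1,\,(p-1)(p^{m-1}-p^{\frac{m-2}{2}})]$ code with weight distribution: weight $0$ occurs $1$ time; weight $(p-1)p^{m-1}$ occurs $(p^m-1)p$ times; each of the weights $(p-1)p^{m-1}\pm(p-1)p^{\frac{m-2}{2}}$ occurs $\frac12(p^m-1)p^m$ times; each of the weights $(p-1)p^{m-1}\pm p^{\frac{m-2}{2}}$ occurs $\frac12(p^m-1)(p-1)p^m$ times; weight $p^m$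 occurs $p-1$ times. (3) If $p=3$ and $m>1$, then $\bar{\mathcal C}_f^{\perp}$ is a $[3^m,\,3^m-2m-1,\,5]$ code, and it is distance-optimal with respect to the bound of El Rouayheb et al., which says that a $q$-ary code of length $n$ and minimum distance at least $d$ has at most $q^{t+2r}\big/\sum_{i=0}^{r}\binom{t+2r}{i}(q-1)^i$ codewords, where $t=n-d+1$ and $r=\left\lfloor\min\{\frac{n-t}{2},\frac{t-1}{q-2}\}\right\rfloor$. If $p>3$, then $\bar{\mathcal C}_f^{\perp}$ is a $[p^m,\,p^m-2m-1,\,4]$ code, and it is distance-optimal with respect to the Sphere Packing bound, which says that a $q$-ary $[n,k,d]$ code satisfies $q^k\le q^n\big/\sum_{i=0}^{\lfloor (d-1)/2\rfloor}\binom{n}{i}(q-1)^i$. -/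

import Mathlib

open Polynomial

section Codes

variable {K : Type*} [Field K] [DecidableEq K] {ι : Type*} [Fintype ι]

/-- `C` is an `[n, k, d]` code over `K`: a `k`-dimensional subspace of `K ^ n` whose minimum
Hamming distance (between distinct codewords) exists and equals `d`. -/
def IsLinearCode (C : Submodule K (ι → K)) (n k d : ℕ) : Prop :=
  Fintype.card ι = n ∧ Module.finrank K C = k ∧
    IsLeast {e : ℕ | ∃ x ∈ C, ∃ y ∈ C, x ≠ y ∧ hammingDist x y = e} d

/-- `A_i`: the number of codewords of `C` of Hamming weight `i`. -/
noncomputable def weightCount (C : Submodule K (ι → K)) (i : ℕ) : ℕ :=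
  {c : ι → K | c ∈ C ∧ hammingNorm c = i}.ncard

/-- The weight distribution of `C` is given by the table `T`, a list of rows
`(weight, number of times it occurs)`. The multiplicities of rows with the same weight add up,
and a weight that is not listed does not occur. -/
def HasWeightDistribution (C : Submodule K (ι → K)) (T : List (ℕ × ℕ)) : Prop :=
  ∀ i : ℕ, weightCount C i = ((T.filter (fun r => r.1 = i)).map Prod.snd).sum

/-- The parameters `[n, k, d]` are distance-optimal over `K`: there is no `[n, k, d + 1]` code
over `K`. -/
def DistanceOptimal (K : Type*) [Field K] [DecidableEq K] (n k d : ℕ) : Prop :=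
  ¬ ∃ C : Submodule K (Fin n → K), IsLinearCode C n k (d + 1)

end Codes

/-- The dual code, with respect to the standard inner product `∑ i, v i * c i`. -/
def dualCode {K : Type*} [Field K] {ι : Type*} [Fintype ι] (C : Submodule K (ι → K)) :
    Submodule K (ι → K) where
  carrier := {v | ∀ c ∈ C, ∑ i, v i * c i = 0}
  zero_mem' := by intro c _; simp
  add_mem' := by
    intro u v hu hv c hc
    simp [add_mul, Finset.sum_add_distrib, hu c hc, hv c hc]
  smul_mem' := by
    intro t v hv c hc
    simp [mul_assoc, ← Finset.mul_sum, hv c hc]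

/-- The Sphere Packing upper bound `q ^ n / ∑_{i ≤ ⌊(d - 1) / 2⌋} (n choose i) (q - 1) ^ i` on the
number `q ^ k` of codewords of a `q`-ary `[n, k, d]` code. -/
def spherePackingBound (q n d : ℕ) : ℚ :=
  (q : ℚ) ^ n / ∑ i ∈ Finset.range ((d - 1) / 2 + 1), (n.choose i : ℚ) * ((q : ℚ) - 1) ^ i

/-- The upper bound of El Rouayheb, Georghiades, Soljanin and Sprintson on the number of codewords
of a `q`-ary code of length `n` and minimum distance at least `d` (for `1 ≤ d ≤ n`, `3 ≤ q`): with
`t = n - d + 1` and `r = ⌊min ((n - t) / 2) ((t - 1) / (q - 2))⌋` it is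
`q ^ (t + 2 r) / ∑_{i ≤ r} (t + 2 r choose i) (q - 1) ^ i`. -/
def elRouayhebBound (q n d : ℕ) : ℚ :=
  let t : ℕ := n - d + 1
  let r : ℕ := min ((n - t) / 2) ((t - 1) / (q - 2))
  (q : ℚ) ^ (t + 2 * r) /
    ∑ i ∈ Finset.range (r + 1), ((t + 2 * r).choose i : ℚ) * ((q : ℚ) - 1) ^ i

section PlanarFunctions

variable {F : Type*} [Field F]

/-- `f` is perfect nonlinear (planar): the maximum over `a ≠ 0` and `b` of the number of solutions
`x` of `f (x + a) - f x = b` is `1`. -/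
def IsPerfectNonlinear (f : F → F) : Prop :=
  IsGreatest {N : ℕ | ∃ a : F, a ≠ 0 ∧ ∃ b : F, {x : F | f (x + a) - f x = b}.ncard = N} 1

/-- The algebraic degree of `f : F → F` in characteristic `p` is `d`: in the unique polynomial of
degree less than `|F|` that represents `f`, the largest base-`p` digit sum of the exponent of a
monomial that occurs is `d`. -/
def HasAlgebraicDegree [Fintype F] (p : ℕ) (f : F → F) (d : ℕ) : Prop :=
  ∃ P : F[X], P.natDegree < Fintype.card F ∧ (∀ x, P.eval x = f x) ∧
    P.support.sup (fun i => (Nat.digits p i).sum) = d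

/-- PN-DO functions: perfect nonlinear functions of algebraic degree `2`. -/
def IsPNDO [Fintype F] (p : ℕ) (f : F → F) : Prop :=
  IsPerfectNonlinear f ∧ HasAlgebraicDegree p f 2

end PlanarFunctions

/-- The code of all words `(Tr (a f(x) + b x) + c)_{x ∈ F}` with `a, b ∈ F` and `c ∈ 𝔽_p`, where
`Tr` is the absolute trace; the coordinates are indexed by the elements of `F`. -/
def puncturedCode (p : ℕ) [Fact p.Prime] {F : Type*} [Field F] [Algebra (ZMod p) F]
    (f : F → F) : Submodule (ZMod p) (F → ZMod p) where
  carrier := {v | ∃ (a b : F) (c : ZMod p),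
    v = fun x => Algebra.trace (ZMod p) F (a * f x + b * x) + c}
  zero_mem' := ⟨0, 0, 0, by ext x; simp⟩
  add_mem' := by
    rintro _ _ ⟨a, b, c, rfl⟩ ⟨a', b', c', rfl⟩
    refine ⟨a + a', b + b', c + c', ?_⟩
    ext x
    simp only [Pi.add_apply, add_mul, map_add]
    ring
  smul_mem' := by
    rintro t _ ⟨a, b, c, rfl⟩
    refine ⟨t • a, t • b, t * c, ?_⟩
    ext x
    simp only [Pi.smul_apply, smul_eq_mul, smul_mul_assoc, map_add, map_smul]
    ring

/-! ### Sphere packing, plain and punctured. -/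

section SpherePacking

variable {K : Type*} [Field K] [Fintype K] [DecidableEq K] {ι : Type*} [Fintype ι] [DecidableEq ι]

theorem card_filter_hammingNorm_eq (j : ℕ) :
    (Finset.univ.filter fun v : ι → K => hammingNorm v = j).card =
      (Fintype.card ι).choose j * (Fintype.card K - 1) ^ j := by
  have h : (Finset.univ.filter fun v : ι → K => hammingNorm v = j) =
      (Finset.univ.powersetCard j).biUnion fun S : Finset ι =>
        Fintype.piFinset fun i => if i ∈ S then Finset.univ.erase (0 : K) else {0} := by
    ext v
    simp only [Finset.mem_filter, Finset.mem_univ, true_and, Finset.mem_biUnion,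
      Finset.mem_powersetCard, Finset.subset_univ, Fintype.mem_piFinset]
    constructor
    · intro hv
      refine ⟨Finset.univ.filter fun i => v i ≠ 0, hv, fun i => ?_⟩
      by_cases hi : v i = 0 <;> simp [hi]
    · rintro ⟨S, hS, hv⟩
      rw [← hS, hammingNorm]
      congr 1
      ext i
      have := hv i
      by_cases hi : i ∈ S <;> simp_all
  rw [h, Finset.card_biUnion]
  · rw [Finset.sum_congr rfl (g := fun _ => (Fintype.card K - 1) ^ j)]
    · simp
    · intro S hS
      rw [Fintype.card_piFinset]
      have : ∀ i, (if i ∈ S then Finset.univ.erase (0 : K) else {0}).card =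
          if i ∈ S then Fintype.card K - 1 else 1 := by
        intro i
        split_ifs <;> simp [Finset.card_erase_of_mem]
      simp_rw [this]
      rw [Finset.prod_ite]
      simp [(Finset.mem_powersetCard.1 hS).2]
  · intro S _ T _ hST
    rw [Function.onFun, Finset.disjoint_left]
    intro v hv hv'
    apply hST
    ext i
    have h1 := Fintype.mem_piFinset.1 hv i
    have h2 := Fintype.mem_piFinset.1 hv' i
    by_cases hi : i ∈ S <;> by_cases hj : i ∈ T <;> simp_all

theorem card_filter_hammingNorm_lt (r : ℕ) :
    (Finset.univ.filter fun v : ι → K => hammingNorm v < r).card =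
      ∑ j ∈ Finset.range r, (Fintype.card ι).choose j * (Fintype.card K - 1) ^ j := by
  simp_rw [← card_filter_hammingNorm_eq]
  rw [← Finset.card_biUnion]
  · congr 1
    ext v
    simp
  · intro i _ j _ hij
    rw [Function.onFun, Finset.disjoint_left]
    intro v hv hv'
    simp only [Finset.mem_filter, Finset.mem_univ, true_and] at hv hv'
    exact hij (hv.symm.trans hv')

/-- The balls of radius `r` around codewords are disjoint: codeword plus error determines both. -/
theorem card_mul_sum_choose_le (C : Finset (ι → K)) (r : ℕ)
    (hC : ∀ x ∈ C, ∀ y ∈ C, x ≠ y → 2 * r < hammingDist x y) :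
    C.card * ∑ j ∈ Finset.range (r + 1), (Fintype.card ι).choose j * (Fintype.card K - 1) ^ j ≤
      Fintype.card K ^ Fintype.card ι := by
  rw [← card_filter_hammingNorm_lt, ← Finset.card_product, ← Fintype.card_fun, ← Finset.card_univ]
  refine Finset.card_le_card_of_injOn (fun z => z.1 + z.2) (fun _ _ => by simp) ?_
  rintro ⟨x, e⟩ hx ⟨y, e'⟩ hy hxy
  simp only [Finset.coe_product, Set.mem_prod, Finset.mem_coe, Finset.mem_filter,
    Finset.mem_univ, true_and] at hx hy hxy
  have : x = y := by
    by_contra hne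
    have h1 := hC x hx.1 y hy.1 hne
    have h2 := hammingDist_triangle x (x + e) y
    have h3 : hammingDist x (x + e) = hammingNorm e := by
      rw [hammingDist_eq_hammingNorm]; simp
    have h4 : hammingDist (x + e) y = hammingNorm e' := by
      rw [hxy, hammingDist_comm, hammingDist_eq_hammingNorm]; simp
    omega
  subst this
  simpa using hxy

/-- Deleting one coordinate lowers the distances of a code by at most one. -/
theorem card_mul_sum_choose_le_of_puncture (i₀ : ι) (C : Finset (ι → K)) (r : ℕ)
    (hC : ∀ x ∈ C, ∀ y ∈ C, x ≠ y → 2 * r + 1 < hammingDist x y) :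
    C.card * ∑ j ∈ Finset.range (r + 1),
        (Fintype.card ι - 1).choose j * (Fintype.card K - 1) ^ j ≤
      Fintype.card K ^ (Fintype.card ι - 1) := by
  let π : (ι → K) → ({i // i ≠ i₀} → K) := fun v i => v i
  have hd : ∀ x y, hammingDist x y ≤ hammingDist (π x) (π y) + 1 := by
    intro x y
    simp only [hammingDist]
    have h : (Finset.univ.filter fun i => x i ≠ y i) ⊆
        insert i₀ ((Finset.univ.filter fun i => π x i ≠ π y i).map
          (Function.Embedding.subtype _)) := by
      intro i hi
      by_cases h : i = i₀
      · simp [h]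
      · simpa [h, π] using hi
    refine (Finset.card_le_card h).trans ((Finset.card_insert_le _ _).trans ?_)
    rw [Finset.card_map]
  have hinj : Set.InjOn π C := by
    intro x hx y hy hxy
    by_contra hne
    have h1 := hC x hx y hy hne
    have h2 := hd x y
    rw [hxy, hammingDist_self] at h2
    omega
  have h := card_mul_sum_choose_le (C.image π) r (by
    intro x' hx' y' hy' hxy
    obtain ⟨x, hx, rfl⟩ := Finset.mem_image.1 hx'
    obtain ⟨y, hy, rfl⟩ := Finset.mem_image.1 hy'
    have h1 := hC x hx y hy (fun h => hxy (by rw [h]))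
    have h2 := hd x y
    omega)
  rw [Finset.card_image_of_injOn hinj] at h
  simpa [Fintype.card_subtype_compl] using h

omit [DecidableEq K] [DecidableEq ι] [Fintype ι] in
theorem pow_finrank_eq_card_toFinset [Finite ι] (C : Submodule K (ι → K))
    [Fintype (C : Set (ι → K))] :
    Fintype.card K ^ Module.finrank K C = (C : Set (ι → K)).toFinset.card := by
  cases nonempty_fintype ι
  rw [Set.toFinset_card]
  exact (Module.card_eq_pow_finrank (K := K) (V := C)).symm

theorem pow_finrank_mul_sum_choose_le (C : Submodule K (ι → K)) (r : ℕ)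
    (hC : ∀ x ∈ C, ∀ y ∈ C, x ≠ y → 2 * r < hammingDist x y) :
    Fintype.card K ^ Module.finrank K C *
      ∑ j ∈ Finset.range (r + 1), (Fintype.card ι).choose j * (Fintype.card K - 1) ^ j ≤
      Fintype.card K ^ Fintype.card ι := by
  classical
  rw [pow_finrank_eq_card_toFinset]
  exact card_mul_sum_choose_le _ r fun x hx y hy => hC x (by simpa using hx) y (by simpa using hy)

theorem pow_finrank_mul_sum_choose_le_of_puncture (i₀ : ι) (C : Submodule K (ι → K)) (r : ℕ)
    (hC : ∀ x ∈ C, ∀ y ∈ C, x ≠ y → 2 * r + 1 < hammingDist x y) :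
    Fintype.card K ^ Module.finrank K C *
      ∑ j ∈ Finset.range (r + 1),
        (Fintype.card ι - 1).choose j * (Fintype.card K - 1) ^ j ≤
      Fintype.card K ^ (Fintype.card ι - 1) := by
  classical
  rw [pow_finrank_eq_card_toFinset]
  exact card_mul_sum_choose_le_of_puncture i₀ _ r
    fun x hx y hy => hC x (by simpa using hx) y (by simpa using hy)

end SpherePacking

/-! ### Dual dimension and minimum distance of linear codes. -/

/-- The dot product identifies the dual code with the dual annihilator of `C`. -/
theorem finrank_dualCode {K : Type*} [Field K] {ι : Type*} [Fintype ι]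
    (C : Submodule K (ι → K)) :
    Module.finrank K (dualCode C) = Fintype.card ι - Module.finrank K C := by
  classical
  have h : dualCode C = C.dualAnnihilator.comap (dotProductEquiv K ι).toLinearMap := by
    ext v
    simp only [Submodule.mem_comap, Submodule.mem_dualAnnihilator]
    rfl
  have h2 := Subspace.finrank_add_finrank_dualAnnihilator_eq C
  rw [h, LinearEquiv.finrank_eq ((dotProductEquiv K ι).submoduleMap _),
    Submodule.map_comap_eq_of_surjective
    (dotProductEquiv K ι).surjective]
  rw [Module.finrank_fintype_fun_eq_card] at h2
  omega

theorem isLeast_hammingDist {K : Type*} [Field K] [DecidableEq K] {ι : Type*} [Fintype ι]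
    {C : Submodule K (ι → K)} {d : ℕ} (hC : ∃ v ∈ C, v ≠ 0 ∧ hammingNorm v = d)
    (h : ∀ v ∈ C, v ≠ 0 → d ≤ hammingNorm v) :
    IsLeast {e : ℕ | ∃ x ∈ C, ∃ y ∈ C, x ≠ y ∧ hammingDist x y = e} d := by
  obtain ⟨v, hv, hv0, hvd⟩ := hC
  refine ⟨⟨v, hv, 0, C.zero_mem, hv0, by rw [hammingDist_zero_right, hvd]⟩, ?_⟩
  rintro _ ⟨x, hx, y, hy, hxy, rfl⟩
  rw [hammingDist_eq_hammingNorm]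
  refine h _ (by simpa [neg_add_eq_sub, sub_eq_add_neg] using C.add_mem (C.neg_mem hx) hy) ?_
  intro h0
  exact hxy (by simpa using neg_add_eq_zero.1 h0)

/-! ### Numerical estimates for the two bounds. -/

section Bounds

/-- The volume of a ball of radius 2, arranged without division or subtraction in `ℕ`. -/
theorem sum_range_three_choose_mul (n a : ℕ) :
    2 * ∑ j ∈ Finset.range 3, n.choose j * a ^ j + n * a ^ 2 = 2 + 2 * n * a + n ^ 2 * a ^ 2 := by
  have h : 2 * n.choose 2 + n = n ^ 2 := by
    have := Nat.choose_two_right n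
    have h2 := Nat.triangle_succ n
    have h3 : n * (n - 1) + n = n ^ 2 := by
      cases n <;> simp; ring
    have h4 : 2 ∣ n * (n - 1) := (Nat.even_mul_pred_self n).two_dvd
    omega
  simp only [Finset.sum_range_succ, Finset.sum_range_zero, Nat.choose_zero_right,
    Nat.choose_one_right]
  calc _ = (2 * n.choose 2 + n) * a ^ 2 + 2 + 2 * n * a := by ring
    _ = _ := by rw [h]; ring

/-- The leading coefficient `(p - 1) ^ 2 / 2` of the ball volume exceeds `p` from `p = 5` on, but
not at `p = 3`; hence the separate punctured estimate in the ternary case. -/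
theorem mul_lt_sum_range_three_choose {p n : ℕ} (hp : 5 ≤ p) (hn : 5 ≤ n) :
    p * n ^ 2 < ∑ j ∈ Finset.range 3, n.choose j * (p - 1) ^ j := by
  obtain ⟨a, rfl⟩ : ∃ a, p = a + 5 := ⟨p - 5, by omega⟩
  obtain ⟨b, rfl⟩ : ∃ b, n = b + 5 := ⟨n - 5, by omega⟩
  have h := sum_range_three_choose_mul (b + 5) (a + 5 - 1)
  simp only [show a + 5 - 1 = a + 4 by omega] at *
  nlinarith [Nat.zero_le (a * b), Nat.zero_le (a ^ 2 * b), Nat.zero_le (a * b ^ 2),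
    Nat.zero_le (a ^ 2 * b ^ 2), Nat.zero_le (a ^ 2), Nat.zero_le (b ^ 2)]

theorem sq_lt_sum_range_three_choose {n : ℕ} (hn : 9 ≤ n) :
    n ^ 2 < ∑ j ∈ Finset.range 3, (n - 1).choose j * (3 - 1) ^ j := by
  obtain ⟨b, rfl⟩ : ∃ b, n = b + 9 := ⟨n - 9, by omega⟩
  have h := sum_range_three_choose_mul (b + 9 - 1) (3 - 1)
  simp only [show b + 9 - 1 = b + 8 by omega] at *
  nlinarith

theorem spherePackingBound_lt {p n k : ℕ} (hp : 5 ≤ p) (hk : p ^ n = p ^ k * (p * n ^ 2))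
    (hn : 5 ≤ n) : spherePackingBound p n (4 + 1) < (p : ℚ) ^ k := by
  have h := mul_lt_sum_range_three_choose hp hn
  have h1 : ∑ i ∈ Finset.range ((4 + 1 - 1) / 2 + 1), (n.choose i : ℚ) * ((p : ℚ) - 1) ^ i =
      ((∑ j ∈ Finset.range 3, n.choose j * (p - 1) ^ j : ℕ) : ℚ) := by
    push_cast [Nat.cast_sub (show 1 ≤ p by omega)]
    rfl
  rw [spherePackingBound, h1, div_lt_iff₀ (by exact_mod_cast (Nat.zero_le _).trans_lt h)]
  exact_mod_cast hk ▸ Nat.mul_lt_mul_of_pos_left h (by positivity)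

/-- At `q = 3`, `d = 6` one has `t = n - 5` and `r = 2`, so the bound is sphere packing in length `t
+ 2 r = n - 1`. -/
theorem elRouayhebBound_lt {n k : ℕ} (hn : 9 ≤ n) (hk : 3 ^ (n - 1) = 3 ^ k * n ^ 2) :
    elRouayhebBound 3 n (5 + 1) < (3 : ℚ) ^ k := by
  have h := sq_lt_sum_range_three_choose hn
  have h2 : min ((n - (n - (5 + 1) + 1)) / 2) ((n - (5 + 1) + 1 - 1) / (3 - 2)) = 2 := by omega
  have h3 : n - (5 + 1) + 1 + 2 * 2 = n - 1 := by omega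
  simp only [elRouayhebBound, h2, h3]
  have h1 : ∑ i ∈ Finset.range (2 + 1), ((n - 1).choose i : ℚ) * (((3 : ℕ) : ℚ) - 1) ^ i =
      ((∑ j ∈ Finset.range 3, (n - 1).choose j * (3 - 1) ^ j : ℕ) : ℚ) := by
    push_cast
    norm_num
  rw [h1, div_lt_iff₀ (by exact_mod_cast (Nat.zero_le _).trans_lt h)]
  exact_mod_cast hk ▸ Nat.mul_lt_mul_of_pos_left h (by positivity)

end Bounds

/-! ### Solutions of quadratic equations over a finite field of odd characteristic. -/

section QuadraticCounting

variable {K : Type*} [Field K] [Fintype K] [DecidableEq K]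

/-- An element `u` has `1 + χ u` square roots, and `χ (s / w) = χ (w * s)`. -/
theorem sum_comp_mul_sq (hK : ringChar K ≠ 2) (w : Kˣ) (g : K → ℤ) :
    ∑ y : K, g (w * y ^ 2) = ∑ s, (1 + quadraticChar K (w * s)) * g s := by
  have h : ∀ g : K → ℤ, ∑ y : K, g (y ^ 2) = ∑ s, (1 + quadraticChar K s) * g s := by
    intro g
    rw [← Finset.sum_fiberwise Finset.univ (fun y : K => y ^ 2)]
    refine Finset.sum_congr rfl fun s _ => ?_
    have h1 := quadraticChar_card_sqrts hK s
    rw [Set.toFinset_ofPred] at h1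
    rw [Finset.sum_congr rfl (g := fun _ => g s)
      (fun y hy => by rw [(Finset.mem_filter.1 hy).2]), Finset.sum_const, nsmul_eq_mul, h1, add_comm]
  rw [h (fun y => g (w * y)), ← Equiv.sum_comp w.mulLeft (fun s => (1 + quadraticChar K (w * s)) * g s)]
  refine Finset.sum_congr rfl fun s _ => ?_
  rw [Units.mulLeft_apply, ← mul_assoc, ← sq, map_mul, quadraticChar_sq_one' w.ne_zero, one_mul]

theorem sum_quadraticChar_mul_left (hK : ringChar K ≠ 2) (w : Kˣ) :
    ∑ s, quadraticChar K (w * s) = 0 := by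
  simp_rw [map_mul, ← Finset.mul_sum, quadraticChar_sum_zero hK, mul_zero]

theorem sum_quadraticChar_sub_left (hK : ringChar K ≠ 2) (t : K) :
    ∑ s, quadraticChar K (t - s) = 0 :=
  (Equiv.sum_comp (Equiv.subLeft t) (fun s => quadraticChar K s)).trans (quadraticChar_sum_zero hK)

theorem sum_quadraticChar_sq :
    ∑ s, quadraticChar K s ^ 2 = (Fintype.card K : ℤ) - 1 := by
  have : ∀ s : K, quadraticChar K s ^ 2 = 1 - if s = 0 then 1 else 0 := by
    intro s
    by_cases hs : s = 0
    · simp [hs]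
    · rw [quadraticChar_sq_one hs, if_neg hs, sub_zero]
  simp_rw [this]
  simp

theorem sum_quadraticChar_mul_quadraticChar_sub (hK : ringChar K ≠ 2) (t : K) :
    ∑ s, quadraticChar K s * quadraticChar K (t - s) =
      quadraticChar K (-1) * if t = 0 then (Fintype.card K : ℤ) - 1 else -1 := by
  split_ifs with ht
  · subst ht
    rw [← sum_quadraticChar_sq, Finset.mul_sum]
    refine Finset.sum_congr rfl fun s _ => ?_
    rw [zero_sub, ← neg_one_mul s, map_mul]
    ring
  -- Scaling `s` by `t` turns the sum into the Jacobi sum of `χ` with `χ⁻¹ = χ`.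
  · have h := jacobiSum_nontrivial_inv (quadraticChar_ne_one hK)
    rw [(quadraticChar_isQuadratic K).inv, jacobiSum] at h
    rw [mul_neg_one, ← h, ← Equiv.sum_comp (Units.mk0 t ht).mulLeft]
    refine Finset.sum_congr rfl fun s _ => ?_
    rw [Units.mulLeft_apply, Units.val_mk0, ← mul_one_sub, map_mul, map_mul]
    linear_combination (quadraticChar K s * quadraticChar K (1 - s)) * quadraticChar_sq_one ht

/-- The deviation of the number of solutions of a nondegenerate quadratic equation in `n` variables
from its mean, up to sign. -/
noncomputable def quadDeviation (n : ℕ) (t : K) : ℤ :=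
  if Even n then (Fintype.card K : ℤ) ^ (n / 2) * (if t = 0 then (Fintype.card K : ℤ) - 1 else -1)
  else (Fintype.card K : ℤ) ^ ((n + 1) / 2) * quadraticChar K t

/-- The induction step for adding one square. What matters is that `δ` does not depend on `t`; its
value (essentially the discriminant) is never needed. -/
theorem sum_mul_quadDeviation (hK : ringChar K ≠ 2) (w : Kˣ) (n : ℕ) :
    ∃ δ : ℤ, (δ = 1 ∨ δ = -1) ∧ ∀ t : K,
      ∑ s, (1 + quadraticChar K (w * s)) * quadDeviation n (t - s) =
        δ * quadDeviation (n + 1) t := by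
  have hw := quadraticChar_dichotomy w.ne_zero
  by_cases hn : Even n
  · refine ⟨quadraticChar K w, hw, fun t => ?_⟩
    have h1 : ¬ Even (n + 1) := by simpa [Nat.even_add_one] using hn
    simp only [quadDeviation, hn, h1, if_true, if_false]
    have h2 : ∀ s, (1 + quadraticChar K (w * s)) * ((Fintype.card K : ℤ) ^ (n / 2) *
        (if t - s = 0 then (Fintype.card K : ℤ) - 1 else -1)) =
        (Fintype.card K : ℤ) ^ (n / 2) * ((if t = s then
          (1 + quadraticChar K (w * s)) * (Fintype.card K : ℤ) else 0)
            - 1 - quadraticChar K (w * s)) := by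
      intro s
      by_cases h : t = s
      · simp only [h, sub_self, if_true]; ring
      · simp only [h, sub_eq_zero, if_false]; ring
    simp_rw [h2]
    rw [← Finset.mul_sum, Finset.sum_sub_distrib, Finset.sum_sub_distrib,
      sum_quadraticChar_mul_left hK, Finset.sum_ite_eq]
    have h3 : (n + 1 + 1) / 2 = n / 2 + 1 := by omega
    rw [if_pos (Finset.mem_univ t), h3, map_mul]
    simp only [Finset.sum_const, Finset.card_univ, nsmul_eq_mul]
    ring
  · refine ⟨quadraticChar K w * quadraticChar K (-1), ?_, fun t => ?_⟩
    · have := quadraticChar_dichotomy (F := K) (a := -1) (by simp)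
      rcases hw with h | h <;> rcases this with h' | h' <;> simp [h, h']
    have h1 : Even (n + 1) := by simpa [Nat.even_add_one] using hn
    simp only [quadDeviation, hn, h1, if_true, if_false]
    have h2 : ∀ s, (1 + quadraticChar K (w * s)) * ((Fintype.card K : ℤ) ^ ((n + 1) / 2) *
        quadraticChar K (t - s)) = (Fintype.card K : ℤ) ^ ((n + 1) / 2) * (quadraticChar K (t - s) +
          quadraticChar K w * (quadraticChar K s * quadraticChar K (t - s))) := by
      intro s
      rw [map_mul]
      ring
    simp_rw [h2]
    rw [← Finset.mul_sum, Finset.sum_add_distrib, ← Finset.mul_sum,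
      sum_quadraticChar_mul_quadraticChar_sub hK, sum_quadraticChar_sub_left hK]
    ring

theorem card_weightedSumSquares_eq (hK : ringChar K ≠ 2) (n : ℕ) (w : Fin n → Kˣ) :
    ∃ ε : ℤ, (ε = 1 ∨ ε = -1) ∧ ∀ t : K, (Fintype.card K : ℤ) *
      (Finset.univ.filter fun x : Fin n → K => ∑ i, (w i : K) * x i ^ 2 = t).card =
        (Fintype.card K : ℤ) ^ n + ε * quadDeviation n t := by
  induction n with
  | zero =>
    refine ⟨1, Or.inl rfl, fun t => ?_⟩
    by_cases ht : t = 0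
    · simp [quadDeviation, ht]
    · simp [quadDeviation, ht, Ne.symm ht]
  | succ n ih =>
    obtain ⟨ε, hε, h⟩ := ih (fun i => w i.succ)
    obtain ⟨δ, hδ, hδ'⟩ := sum_mul_quadDeviation hK (w 0) n
    refine ⟨ε * δ, by rcases hε with h | h <;> rcases hδ with h' | h' <;> simp [h, h'], fun t => ?_⟩
    have h1 : ((Finset.univ.filter fun x : Fin (n + 1) → K =>
        ∑ i, (w i : K) * x i ^ 2 = t).card : ℤ) = ∑ y : K,
          ((Finset.univ.filter fun x : Fin n → K =>
            ∑ i, (w i.succ : K) * x i ^ 2 = t - w 0 * y ^ 2).card : ℤ) := by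
      -- Fibre the solutions over the first coordinate `y`.
      simp_rw [Finset.natCast_card_filter]
      rw [← Equiv.sum_comp (Fin.consEquiv fun _ => K), Fintype.sum_prod_type]
      refine Finset.sum_congr rfl fun y _ => Finset.sum_congr rfl fun x _ => ?_
      simp [Fin.sum_univ_succ, eq_sub_iff_add_eq']
    rw [h1, sum_comp_mul_sq hK (w 0) (fun s => ((Finset.univ.filter fun x : Fin n → K =>
      ∑ i, (w i.succ : K) * x i ^ 2 = t - s).card : ℤ)), Finset.mul_sum]
    simp_rw [mul_left_comm (Fintype.card K : ℤ), h, mul_add, Finset.sum_add_distrib, ← Finset.sum_mul,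
      mul_left_comm _ ε, ← Finset.mul_sum, hδ', Finset.sum_add_distrib,
      sum_quadraticChar_mul_left hK]
    simp
    ring

variable {V : Type*} [AddCommGroup V] [Module K V] [Fintype V]

/-- Diagonalize the form and apply the weighted sum of squares count. -/
theorem card_quadratic_eq (hK : ringChar K ≠ 2) (β : LinearMap.BilinForm K V)
    (hs : ∀ x y, β x y = β y x) (hβ : ∀ x, (∀ y, β x y = 0) → x = 0) :
    ∃ ε : ℤ, (ε = 1 ∨ ε = -1) ∧ ∀ t : K, (Fintype.card K : ℤ) *
      (Finset.univ.filter fun x : V => β x x = t).card =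
        (Fintype.card K : ℤ) ^ Module.finrank K V + ε * quadDeviation (Module.finrank K V) t := by
  have h2 : (2 : K) ≠ 0 := Ring.two_ne_zero hK
  have : Invertible (2 : K) := invertibleOfNonzero h2
  let Q : QuadraticForm K V := LinearMap.BilinMap.toQuadraticMap β
  have hQ : QuadraticMap.associated (R := K) Q = β := QuadraticMap.associated_left_inverse K hs
  obtain ⟨w, ⟨e⟩⟩ := Q.equivalent_weightedSumSquares_units_of_nondegenerate' (by
    rw [hQ]; exact fun x hx => hβ x hx)
  obtain ⟨ε, hε, h⟩ := card_weightedSumSquares_eq hK _ w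
  refine ⟨ε, hε, fun t => ?_⟩
  rw [← h t]
  congr 2
  refine Finset.card_equiv e.toLinearEquiv.toEquiv fun x => ?_
  have := e.map_app x
  rw [QuadraticMap.weightedSumSquares_apply] at this
  simp only [Finset.mem_filter, Finset.mem_univ, true_and]
  have h3 : β x x = Q x := rfl
  rw [h3, ← this]
  simp [Units.smul_def, sq]

omit [Fintype K] in
theorem exists_card_quadratic_add_linear_eq [FiniteDimensional K V] (h2 : (2 : K) ≠ 0)
    (β : LinearMap.BilinForm K V)
    (hs : ∀ x y, β x y = β y x) (hβ : ∀ x, (∀ y, β x y = 0) → x = 0) (l : V →ₗ[K] K) :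
    ∃ s : K, ∀ t : K, (Finset.univ.filter fun x : V => β x x + l x = t).card =
      (Finset.univ.filter fun x : V => β x x = t + s).card := by
  have hinj : Function.Injective β := by
    rw [injective_iff_map_eq_zero]
    exact fun x hx => hβ x fun y => by simp [hx]
  have hsurj : Function.Surjective β :=
    (LinearMap.injective_iff_surjective_of_finrank_eq_finrank
      (Subspace.dual_finrank_eq (K := K) (V := V)).symm).1 hinj
  -- Completing the square: with `β z = l / 2`, the shift `x ↦ x + z` absorbs `l` at the cost of the
  -- constant `β z z`.
  obtain ⟨z, hz⟩ := hsurj ((2 : K)⁻¹ • l)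
  refine ⟨β z z, fun t => Finset.card_equiv (Equiv.addRight z) fun x => ?_⟩
  have h : β z x = 2⁻¹ * l x := by simp [hz]
  have h' : l x = 2 * β z x := by rw [h]; field_simp
  simp only [Finset.mem_filter, Finset.mem_univ, true_and, Equiv.coe_addRight, map_add,
    LinearMap.add_apply, hs x z, h']
  constructor
  · intro h; rw [← h]; ring
  · intro h; linear_combination h

theorem card_linear_eq (l : V →ₗ[K] K) (hl : l ≠ 0) (t : K) :
    Fintype.card K * (Finset.univ.filter fun x : V => l x = t).card = Fintype.card V := by
  obtain ⟨v, hv⟩ : ∃ v, l v ≠ 0 := by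
    by_contra! h
    exact hl (LinearMap.ext h)
  have h : ∀ s, (Finset.univ.filter fun x : V => l x = s).card =
      (Finset.univ.filter fun x : V => l x = t).card := by
    intro s
    refine Finset.card_equiv (Equiv.addRight (((t - s) / l v) • v)) fun x => ?_
    simp only [Finset.mem_filter, Finset.mem_univ, true_and, Equiv.coe_addRight, map_add,
      map_smul, smul_eq_mul, div_mul_cancel₀ _ hv]
    constructor
    · intro h; rw [h]; ring
    · intro h; linear_combination h
  rw [← Finset.card_univ (α := V), Finset.card_eq_sum_card_fiberwise (s := Finset.univ) (f := l)
    (t := Finset.univ) (by simp)]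
  simp [h]

end QuadraticCounting

/-! ### Degree 2 functions as quadratic maps over the prime field. -/

theorem exists_list_sum_pow_eq {p : ℕ} (hp : 1 < p) (i : ℕ) :
    ∃ l : List ℕ, l.length = (Nat.digits p i).sum ∧ (l.map (p ^ ·)).sum = i := by
  induction i using Nat.strong_induction_on with
  | _ i ih =>
    rcases Nat.eq_zero_or_pos i with rfl | hi
    · exact ⟨[], by simp⟩
    · obtain ⟨l, hl, hs⟩ := ih (i / p) (Nat.div_lt_self hi hp)
      -- The units digit contributes that many copies of `p ^ 0`; the higher digits are those of `i
      -- / p`, shifted by one.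
      refine ⟨List.replicate (i % p) 0 ++ l.map Nat.succ, ?_, ?_⟩
      · rw [Nat.digits_def' hp hi]
        simp [hl]
      · have h : (List.map ((fun x => p ^ x) ∘ Nat.succ) l).sum = p * (l.map (p ^ ·)).sum := by
          rw [← List.sum_map_mul_left]
          simp [pow_succ', Function.comp_def]
        rw [List.map_append, List.map_map, List.sum_append, h, hs]
        simpa using Nat.mod_add_div i p

section Decomposition

variable (p : ℕ) [Fact p.Prime] {F : Type*} [Field F] [Algebra (ZMod p) F]

/-- `f` is the sum of a quadratic form, a linear map and a constant over `𝔽_p`, where the quadratic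
form is the diagonal of the symmetric bilinear map `B`. -/
structure IsQuadratic (f : F → F) (B : F →ₗ[ZMod p] F →ₗ[ZMod p] F) (L : F →ₗ[ZMod p] F) (c₀ : F) :
    Prop where
  symm : ∀ x y, B x y = B y x
  eq : ∀ x, f x = B x x + L x + c₀

variable {p}

theorem IsQuadratic.add {f g : F → F} {B B' : F →ₗ[ZMod p] F →ₗ[ZMod p] F} {L L' : F →ₗ[ZMod p] F}
    {c c' : F} (hf : IsQuadratic p f B L c) (hg : IsQuadratic p g B' L' c') :
    IsQuadratic p (f + g) (B + B') (L + L') (c + c') where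
  symm x y := by simp [hf.symm x y, hg.symm x y]
  eq x := by simp only [Pi.add_apply, hf.eq, hg.eq, LinearMap.add_apply]; ring

theorem exists_linearMap_pow (a : ℕ) : ∃ φ : F →ₗ[ZMod p] F, ∀ x, φ x = x ^ p ^ a := by
  have : CharP F p := charP_of_injective_algebraMap (algebraMap (ZMod p) F).injective p
  exact ⟨(iterateFrobenius F p a).toAddMonoidHom.toZModLinearMap p, fun x => rfl⟩

theorem two_ne_zero_of_algebra_zmod (hp : p ≠ 2) : (2 : F) ≠ 0 := by
  have : CharP F p := charP_of_injective_algebraMap (algebraMap (ZMod p) F).injective p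
  exact Ring.two_ne_zero (by rwa [ringChar.eq F p])

/-- The exponent is `0`, `p ^ a` or `p ^ a + p ^ b`, and Frobenius powers are `𝔽_p`-linear. In the
last case the product is symmetrized, which costs the factor `1 / 2`. -/
theorem exists_isQuadratic_monomial (hp : p ≠ 2) {i : ℕ} (hi : (Nat.digits p i).sum ≤ 2) (r : F) :
    ∃ B L c₀, IsQuadratic p (fun x : F => r * x ^ i) B L c₀ := by
  have h2 : (2 : F) ≠ 0 := two_ne_zero_of_algebra_zmod hp
  obtain ⟨l, hl, rfl⟩ := exists_list_sum_pow_eq (Fact.out : p.Prime).one_lt i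
  rw [← hl] at hi
  match l, hi with
  | [], _ => exact ⟨0, 0, r, by simp, by simp⟩
  | [a], _ =>
    obtain ⟨φ, hφ⟩ := exists_linearMap_pow (p := p) (F := F) a
    exact ⟨0, LinearMap.mulLeft (ZMod p) r ∘ₗ φ, 0, by simp, by simp [hφ]⟩
  | [a, b], _ =>
    obtain ⟨φ, hφ⟩ := exists_linearMap_pow (p := p) (F := F) a
    obtain ⟨ψ, hψ⟩ := exists_linearMap_pow (p := p) (F := F) b
    refine ⟨((LinearMap.mul (ZMod p) F).compl₁₂ φ ψ + (LinearMap.mul (ZMod p) F).compl₁₂ ψ φ).compr₂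
      (LinearMap.mulLeft (ZMod p) (r / 2)), 0, 0, ?_, ?_⟩
    · intro x y
      simp only [LinearMap.compr₂_apply, LinearMap.add_apply, LinearMap.compl₁₂_apply,
        LinearMap.mul_apply', LinearMap.mulLeft_apply]
      ring
    · intro x
      simp only [LinearMap.compr₂_apply, LinearMap.add_apply, LinearMap.compl₁₂_apply,
        LinearMap.mul_apply', LinearMap.mulLeft_apply, hφ, hψ, List.map_cons, List.map_nil,
        List.sum_cons, List.sum_nil, LinearMap.zero_apply]
      field_simp
      ring

theorem HasAlgebraicDegree.exists_isQuadratic [Fintype F] (hp : p ≠ 2) {f : F → F}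
    (hf : HasAlgebraicDegree p f 2) : ∃ B L c₀, IsQuadratic p f B L c₀ := by
  obtain ⟨P, -, hP, hdeg⟩ := hf
  have h : ∀ S ⊆ P.support, ∃ B L c₀,
      IsQuadratic p (fun x => ∑ i ∈ S, P.coeff i * x ^ i) B L c₀ := by
    classical
    intro S
    induction S using Finset.induction_on with
    | empty => exact fun _ => ⟨0, 0, 0, by simp, by simp⟩
    | insert i S hi ih =>
      intro hS
      obtain ⟨B, L, c, h⟩ := ih ((Finset.subset_insert i S).trans hS)
      obtain ⟨B', L', c', h'⟩ := exists_isQuadratic_monomial hp (i := i)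
        (hdeg ▸ Finset.le_sup (f := fun i => (Nat.digits p i).sum)
          (hS (Finset.mem_insert_self i S))) (P.coeff i)
      refine ⟨B' + B, L' + L, c' + c, ?_⟩
      convert h'.add h using 1
      ext x
      rw [Finset.sum_insert hi]
      rfl
  obtain ⟨B, L, c, h⟩ := h _ subset_rfl
  refine ⟨B, L, c, h.symm, fun x => ?_⟩
  rw [← h.eq, ← hP, Polynomial.eval_eq_sum, Polynomial.sum]

theorem IsPerfectNonlinear.eq_of_sub_eq [Finite F] {f : F → F} (hf : IsPerfectNonlinear f) {a x y : F}
    (ha : a ≠ 0) (h : f (x + a) - f x = f (y + a) - f y) : x = y := by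
  have h1 := hf.2 ⟨a, ha, f (y + a) - f y, rfl⟩
  exact (Set.ncard_le_one (Set.toFinite _)).1 h1 x h y rfl

theorem IsQuadratic.eq_zero_or_eq_zero [Finite F] {f : F → F}
    {B : F →ₗ[ZMod p] F →ₗ[ZMod p] F}
    {L : F →ₗ[ZMod p] F} {c₀ : F} (h : IsQuadratic p f B L c₀) (hf : IsPerfectNonlinear f) {x y : F}
    (hxy : B x y = 0) : x = 0 ∨ y = 0 := by
  by_contra! hne
  -- If `B x y = 0`, the increments of `f` by `y` at `x` and at `0` coincide.
  refine hne.1 (hf.eq_of_sub_eq hne.2 (x := x) (y := 0) ?_)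
  simp only [h.eq, map_add, LinearMap.add_apply, map_zero, LinearMap.zero_apply, hxy, h.symm y x]
  ring

end Decomposition

theorem trace_mul_eq_zero {p : ℕ} [Fact p.Prime] {F : Type*} [Field F] [Finite F]
    [Algebra (ZMod p) F] {a : F} (h : ∀ y, Algebra.trace (ZMod p) F (a * y) = 0) : a = 0 := by
  by_contra ha
  obtain ⟨z, hz⟩ := Algebra.trace_surjective (ZMod p) F 1
  have := h (a⁻¹ * z)
  rw [mul_inv_cancel_left₀ ha, hz] at this
  exact one_ne_zero this

/-! ### Weights of the individual codewords. -/

section Weights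

variable (p : ℕ) [Fact p.Prime] {F : Type*} [Field F] [Algebra (ZMod p) F]

/-- The parametrization of `puncturedCode p f` by the coefficients `(a, b, c)`. -/
noncomputable def codewordMap (f : F → F) : F × F × ZMod p →ₗ[ZMod p] F → ZMod p where
  toFun z := fun x => Algebra.trace (ZMod p) F (z.1 * f x + z.2.1 * x) + z.2.2
  map_add' z z' := by
    ext x
    simp only [Prod.fst_add, Prod.snd_add, Pi.add_apply, add_mul, map_add]
    ring
  map_smul' t z := by
    ext x
    simp only [Prod.smul_fst, Prod.smul_snd, Pi.smul_apply, smul_eq_mul, smul_mul_assoc, map_add,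
      map_smul, RingHom.id_apply]
    ring

theorem range_codewordMap (f : F → F) :
    LinearMap.range (codewordMap p f) = puncturedCode p f := by
  ext v
  constructor
  · rintro ⟨⟨a, b, c⟩, rfl⟩
    exact ⟨a, b, c, rfl⟩
  · rintro ⟨a, b, c, rfl⟩
    exact ⟨(a, b, c), rfl⟩

variable {p}

theorem codewordMap_apply (f : F → F) (a b : F) (c : ZMod p) (x : F) :
    codewordMap p f (a, b, c) x = Algebra.trace (ZMod p) F (a * f x + b * x) + c := rfl

variable [Fintype F] {f : F → F} {B : F →ₗ[ZMod p] F →ₗ[ZMod p] F} {L : F →ₗ[ZMod p] F} {c₀ : F}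

/-- For `x ≠ 0` the map `B x` is injective, hence onto the finite space `F`, and nondegeneracy of
the trace form would force `a = 0`. -/
theorem eq_zero_of_forall_trace_mul_eq_zero (hB : ∀ x y, B x y = 0 → x = 0 ∨ y = 0) {a x : F}
    (ha : a ≠ 0) (hx : ∀ y, Algebra.trace (ZMod p) F (a * B x y) = 0) : x = 0 := by
  by_contra hx0
  have hinj : Function.Injective (B x) := by
    rw [injective_iff_map_eq_zero]
    exact fun y hy => (hB x y hy).resolve_left hx0
  have hsurj := LinearMap.injective_iff_surjective.1 hinj
  refine ha (trace_mul_eq_zero (p := p) fun z => ?_)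
  obtain ⟨y, rfl⟩ := hsurj z
  exact hx y

theorem injective_codewordMap (hp : p ≠ 2) (h : IsQuadratic p f B L c₀)
    (hB : ∀ x y, B x y = 0 → x = 0 ∨ y = 0) : Function.Injective (codewordMap p f) := by
  rw [injective_iff_map_eq_zero]
  rintro ⟨a, b, c⟩ h0
  have h1 : ∀ x, Algebra.trace (ZMod p) F (a * f x + b * x) + c = 0 := fun x => congrFun h0 x
  have h2 : (2 : ZMod p) ≠ 0 := two_ne_zero_of_algebra_zmod hp
  have ha : a = 0 := by
    by_contra ha
    refine one_ne_zero (eq_zero_of_forall_trace_mul_eq_zero (p := p) (x := (1 : F)) hB ha fun y => ?_)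
    -- The second difference in directions `1` and `y` leaves only `2 Tr (a B 1 y)`.
    have e1 := h1 (1 + y)
    have e2 := h1 1
    have e3 := h1 y
    have e4 := h1 0
    simp only [h.eq, map_add, LinearMap.add_apply, h.symm y 1, map_zero,
      mul_add, mul_zero] at e1 e2 e3 e4
    refine (mul_eq_zero.1 ?_).resolve_left h2
    linear_combination e1 - e2 - e3 + e4
  subst ha
  have hc : c = 0 := by simpa using h1 0
  subst hc
  have hb : b = 0 := trace_mul_eq_zero (p := p) fun y => by simpa using h1 y
  subst hb
  rfl

theorem finrank_of_card_eq {m : ℕ} (hF : Fintype.card F = p ^ m) :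
    Module.finrank (ZMod p) F = m := by
  have h := Module.card_eq_pow_finrank (K := ZMod p) (V := F)
  rw [hF, ZMod.card] at h
  exact (Nat.pow_right_injective (Fact.out : p.Prime).two_le h).symm

theorem finrank_puncturedCode {m : ℕ} (hF : Fintype.card F = p ^ m) (hp : p ≠ 2)
    (h : IsQuadratic p f B L c₀) (hB : ∀ x y, B x y = 0 → x = 0 ∨ y = 0) :
    Module.finrank (ZMod p) (puncturedCode p f) = 2 * m + 1 := by
  rw [← range_codewordMap, LinearMap.finrank_range_of_inj (injective_codewordMap hp h hB),
    Module.finrank_prod, Module.finrank_prod, finrank_of_card_eq hF, Module.finrank_self]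
  ring

theorem hammingNorm_add_card_eq_zero {K ι : Type*} [Field K] [DecidableEq K] [Fintype ι]
    (v : ι → K) :
    hammingNorm v + (Finset.univ.filter fun x => v x = 0).card = Fintype.card ι := by
  rw [hammingNorm, add_comm, Finset.card_filter_add_card_filter_not, Finset.card_univ]

/-- The bilinear form attached to the component function `x ↦ Tr (a f(x))`. -/
noncomputable def componentForm (B : F →ₗ[ZMod p] F →ₗ[ZMod p] F) (a : F) :
    LinearMap.BilinForm (ZMod p) F :=
  B.compr₂ (Algebra.trace (ZMod p) F ∘ₗ LinearMap.mulLeft (ZMod p) a)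

theorem componentForm_apply (a x y : F) :
    componentForm B a x y = Algebra.trace (ZMod p) F (a * B x y) := rfl

/-- One sign serves all `b` and `c`: these only move the value `t` at which the same quadratic form
is counted. The count itself is exported too, to determine the distribution of the signs. -/
theorem exists_sign_weight {m : ℕ} (hF : Fintype.card F = p ^ m) (hp : p ≠ 2)
    (h : IsQuadratic p f B L c₀) (hB : ∀ x y, B x y = 0 → x = 0 ∨ y = 0) {a : F} (ha : a ≠ 0) :
    ∃ ε : ℤ, (ε = 1 ∨ ε = -1) ∧
      (∀ t : ZMod p, (p : ℤ) * (Finset.univ.filter fun x => componentForm B a x x = t).card =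
        (p : ℤ) ^ m + ε * quadDeviation m t) ∧
      ∀ b : F, ∃ s : ZMod p, ∀ c : ZMod p, (p : ℤ) * hammingNorm (codewordMap p f (a, b, c)) =
        (p : ℤ) ^ (m + 1) - (p : ℤ) ^ m - ε * quadDeviation m (s - c) := by
  have hs : ∀ x y, componentForm B a x y = componentForm B a y x := fun x y => by
    simp only [componentForm_apply, h.symm x y]
  have hn : ∀ x, (∀ y, componentForm B a x y = 0) → x = 0 :=
    fun x hx => eq_zero_of_forall_trace_mul_eq_zero hB ha hx
  obtain ⟨ε, hε, hcard⟩ := card_quadratic_eq (by rwa [ZMod.ringChar_zmod_n])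
    (componentForm B a) hs hn
  rw [finrank_of_card_eq hF, ZMod.card] at hcard
  refine ⟨ε, hε, hcard, fun b => ?_⟩
  obtain ⟨s, hs⟩ := exists_card_quadratic_add_linear_eq (two_ne_zero_of_algebra_zmod hp)
    (componentForm B a) hs hn (Algebra.trace (ZMod p) F ∘ₗ
      (LinearMap.mulLeft (ZMod p) a ∘ₗ L + LinearMap.mulLeft (ZMod p) b))
  refine ⟨s - Algebra.trace (ZMod p) F (a * c₀), fun c => ?_⟩
  have h1 := hammingNorm_add_card_eq_zero (codewordMap p f (a, b, c))
  have h2 : (Finset.univ.filter fun x => codewordMap p f (a, b, c) x = 0) =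
      Finset.univ.filter fun x => componentForm B a x x + (Algebra.trace (ZMod p) F ∘ₗ
      (LinearMap.mulLeft (ZMod p) a ∘ₗ L + LinearMap.mulLeft (ZMod p) b)) x =
        - c - Algebra.trace (ZMod p) F (a * c₀) := by
    ext x
    simp only [Finset.mem_filter, Finset.mem_univ, true_and, codewordMap_apply, componentForm_apply,
      h.eq, mul_add, map_add, LinearMap.comp_apply, LinearMap.add_apply, LinearMap.mulLeft_apply]
    constructor <;> intro h <;> linear_combination h
  rw [h2, hs, hF] at h1
  have h3 := hcard (- c - Algebra.trace (ZMod p) F (a * c₀) + s)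
  rw [show s - Algebra.trace (ZMod p) F (a * c₀) - c =
    - c - Algebra.trace (ZMod p) F (a * c₀) + s by ring]
  have h4 := congrArg (Nat.cast : ℕ → ℤ) h1
  push_cast at h4
  linear_combination (p : ℤ) * h4 - h3

theorem mul_hammingNorm_linear {m : ℕ} (hF : Fintype.card F = p ^ m) {b : F} (hb : b ≠ 0)
    (c : ZMod p) :
    p * hammingNorm (codewordMap p f (0, b, c)) + p ^ m = p * p ^ m := by
  have h1 := hammingNorm_add_card_eq_zero (codewordMap p f (0, b, c))
  have h2 := card_linear_eq (Algebra.trace (ZMod p) F ∘ₗ LinearMap.mulLeft (ZMod p) b) (fun h =>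
    hb (trace_mul_eq_zero (p := p) fun y => LinearMap.congr_fun h y)) (-c)
  have h3 : (Finset.univ.filter fun x => codewordMap p f (0, b, c) x = 0) =
    Finset.univ.filter fun x => (Algebra.trace (ZMod p) F ∘ₗ LinearMap.mulLeft (ZMod p) b) x = -c := by
    ext x
    simp [codewordMap_apply, eq_neg_iff_add_eq_zero]
  rw [hF, ZMod.card, ← h3] at h2
  rw [hF] at h1
  rw [← h1] at h2 ⊢
  rw [mul_add, h2]

theorem hammingNorm_codewordMap_const (c : ZMod p) :
    hammingNorm (codewordMap p f (0, 0, c)) = if c = 0 then 0 else Fintype.card F := by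
  have : codewordMap p f (0, 0, c) = fun _ => c := by ext; simp [codewordMap_apply]
  rw [this, hammingNorm]
  split_ifs with h <;> simp [h]

theorem weightCount_puncturedCode (hinj : Function.Injective (codewordMap p f)) (i : ℕ) :
    weightCount (puncturedCode p f) i =
      ∑ a, ∑ b, ∑ c, if hammingNorm (codewordMap p f (a, b, c)) = i then 1 else 0 := by
  have h : {v : F → ZMod p | v ∈ puncturedCode p f ∧ hammingNorm v = i} =
      codewordMap p f '' ((Finset.univ.filter fun z => hammingNorm (codewordMap p f z) = i :
        Finset (F × F × ZMod p)) : Set (F × F × ZMod p)) := by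
    ext v
    rw [← range_codewordMap]
    constructor
    · rintro ⟨⟨z, rfl⟩, hz⟩
      exact ⟨z, by simpa using hz, rfl⟩
    · rintro ⟨z, hz, rfl⟩
      exact ⟨⟨z, rfl⟩, by simpa using hz⟩
  rw [weightCount, h, Set.ncard_image_of_injective _ hinj, Set.ncard_coe_finset,
    Finset.card_filter, Fintype.sum_prod_type]
  simp_rw [Fintype.sum_prod_type]

/-- Constants, nonconstant affine functions and the words with `a ≠ 0` are counted separately. In
the last class `b` merely contributes a factor `p ^ m`. -/
theorem weightCount_puncturedCode_eq [DecidableEq F] {m : ℕ} (hm : 0 < m)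
    (hF : Fintype.card F = p ^ m) (hinj : Function.Injective (codewordMap p f)) (i : ℕ)
    (ε : F → ℤ) (hε : ∀ a ≠ 0, ∀ b : F, ∃ s : ZMod p, ∀ c : ZMod p,
      (p : ℤ) * hammingNorm (codewordMap p f (a, b, c)) =
        (p : ℤ) ^ (m + 1) - (p : ℤ) ^ m - ε a * quadDeviation m (s - c)) :
    (weightCount (puncturedCode p f) i : ℤ) =
      (if i = 0 then 1 else 0) + (p - 1) * (if i = p ^ m then 1 else 0) +
      (p ^ m - 1) * p * (if i = (p - 1) * p ^ (m - 1) then 1 else 0) +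
      p ^ m * ∑ a ∈ Finset.univ.erase (0 : F), ∑ t : ZMod p,
        if (p : ℤ) ^ (m + 1) - (p : ℤ) ^ m - ε a * quadDeviation m t = p * i then 1 else 0 := by
  have hp0 : 0 < p := (Fact.out : p.Prime).pos
  rw [weightCount_puncturedCode hinj]
  push_cast
  rw [← Finset.add_sum_erase _ _ (Finset.mem_univ (0 : F)),
    ← Finset.add_sum_erase _ _ (Finset.mem_univ (0 : F)),
    ← Finset.add_sum_erase _ _ (Finset.mem_univ (0 : ZMod p))]
  congr 1
  · congr 1
    · congr 1
      · simp [hammingNorm_codewordMap_const, eq_comm]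
      · rw [Finset.sum_congr rfl (g := fun _ => if i = p ^ m then (1 : ℤ) else 0)]
        · rw [Finset.sum_const, Finset.card_erase_of_mem (Finset.mem_univ _), Finset.card_univ,
            ZMod.card, nsmul_eq_mul]
          push_cast [Nat.cast_sub (show 1 ≤ p from hp0)]
          rfl
        · intro c hc
          simp [hammingNorm_codewordMap_const, Finset.ne_of_mem_erase hc, hF, eq_comm]
    · rw [Finset.sum_congr rfl (g := fun _ => p * if i = (p - 1) * p ^ (m - 1) then (1 : ℤ) else 0)]
      · rw [Finset.sum_const, Finset.card_erase_of_mem (Finset.mem_univ _), Finset.card_univ,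
          hF, nsmul_eq_mul]
        push_cast [Nat.cast_sub (show 1 ≤ p ^ m from Nat.pos_of_ne_zero (by positivity))]
        ring
      · intro b hb
        rw [Finset.sum_congr rfl (g := fun _ => if i = (p - 1) * p ^ (m - 1) then (1 : ℤ) else 0)]
        · simp
        · intro c _
          have h1 := mul_hammingNorm_linear (f := f) hF (Finset.ne_of_mem_erase hb) c
          have h2 : hammingNorm (codewordMap p f (0, b, c)) = (p - 1) * p ^ (m - 1) := by
            obtain ⟨k, rfl⟩ : ∃ k, m = k + 1 := ⟨m - 1, by omega⟩
            obtain ⟨q, rfl⟩ : ∃ q, p = q + 1 := ⟨p - 1, by omega⟩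
            refine Nat.eq_of_mul_eq_mul_left hp0 ?_
            simp only [Nat.add_sub_cancel]
            have : (q + 1) * (q + 1) ^ (k + 1) =
              (q + 1) * (q * (q + 1) ^ k) + (q + 1) ^ (k + 1) := by ring
            omega
          rw [h2]
          simp [eq_comm]
  · rw [Finset.mul_sum]
    refine Finset.sum_congr rfl fun a ha => ?_
    rw [Finset.sum_congr rfl (g := fun _ => ∑ t : ZMod p,
        if (p : ℤ) ^ (m + 1) - (p : ℤ) ^ m - ε a * quadDeviation m t = p * i then (1 : ℤ) else 0)]
    · simp [hF]
    · intro b _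
      obtain ⟨s, hs⟩ := hε a (Finset.ne_of_mem_erase ha) b
      -- Substituting `c ↦ s - c` removes the dependence on `b`.
      rw [← Equiv.sum_comp (Equiv.subLeft s)]
      refine Finset.sum_congr rfl fun c _ => ?_
      have h1 := hs (s - c)
      rw [sub_sub_cancel] at h1
      rw [Equiv.subLeft_apply, ← h1]
      congr 1
      rw [mul_right_inj' (by exact_mod_cast hp0.ne'), Nat.cast_inj]

end Weights

/-! ### The weight distributions and the parameters of the code. -/

/-- As a sum of indicators the table needs no case split when rows coincide, as happens for `m = 1`.
-/
theorem sum_map_filter_eq (T : List (ℕ × ℕ)) (i : ℕ) :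
    ((T.filter (fun r => r.1 = i)).map Prod.snd).sum =
      (T.map fun r => r.2 * if i = r.1 then 1 else 0).sum := by
  induction T with
  | nil => rfl
  | cons r T ih =>
    by_cases h : r.1 = i
    · simp [h, ih]
    · simp [h, Ne.symm h, ih]

theorem isLeast_hammingDist_of_hasWeightDistribution {K : Type*} [Field K] [DecidableEq K]
    {ι : Type*} [Fintype ι] [Finite K] {C : Submodule K (ι → K)} {d : ℕ} {T : List (ℕ × ℕ)}
    (hT : HasWeightDistribution C T) (hd0 : 0 < d) (hd : ∃ r ∈ T, r.1 = d ∧ 0 < r.2)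
    (hle : ∀ r ∈ T, r.1 = 0 ∨ d ≤ r.1) :
    IsLeast {e : ℕ | ∃ x ∈ C, ∃ y ∈ C, x ≠ y ∧ hammingDist x y = e} d := by
  apply isLeast_hammingDist
  · obtain ⟨r, hr, rfl, hr2⟩ := hd
    have h1 : 0 < weightCount C r.1 := by
      rw [hT]
      refine hr2.trans_le (List.le_sum_of_mem ?_)
      exact List.mem_map.2 ⟨r, List.mem_filter.2 ⟨hr, by simp⟩, rfl⟩
    obtain ⟨v, hv, hw⟩ := (Set.ncard_pos (Set.toFinite _)).1 h1
    refine ⟨v, hv, ?_, hw⟩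
    rintro rfl
    rw [hammingNorm_zero] at hw
    omega
  · intro v hv hv0
    have h1 : 0 < weightCount C (hammingNorm v) :=
      (Set.ncard_pos (Set.toFinite _)).2 ⟨v, hv, rfl⟩
    rw [hT] at h1
    obtain ⟨r, hr⟩ : ∃ r, r ∈ T.filter (fun r => r.1 = hammingNorm v) := by
      apply List.exists_mem_of_ne_nil
      intro h
      simp [h] at h1
    obtain ⟨hr, hr1⟩ := List.mem_filter.1 hr
    simp only [decide_eq_true_eq] at hr1
    rcases hle r hr with h | h
    · exact absurd (hr1.symm.trans h) (hammingNorm_ne_zero_iff.2 hv0)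
    · exact hr1 ▸ h

/-- Every function of a sign is affine in it, up to the factor 2, so balanced signs average it. -/
theorem two_mul_sum_sign {α : Type*} (S : Finset α) {ε : α → ℤ} (hε : ∀ a ∈ S, ε a = 1 ∨ ε a = -1)
    (h0 : ∑ a ∈ S, ε a = 0) (h : ℤ → ℤ) :
    2 * ∑ a ∈ S, h (ε a) = S.card * (h 1 + h (-1)) := by
  have h1 : ∀ a ∈ S, 2 * h (ε a) = (h 1 + h (-1)) + ε a * (h 1 - h (-1)) := by
    intro a ha
    rcases hε a ha with h | h <;> rw [h] <;> ring
  rw [Finset.mul_sum, Finset.sum_congr rfl h1, Finset.sum_add_distrib, ← Finset.sum_mul, h0]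
  simp

theorem two_mul_sum_quadraticChar {K : Type*} [Field K] [Fintype K] [DecidableEq K]
    (hK : ringChar K ≠ 2) (h : ℤ → ℤ) :
    2 * ∑ t : K, h (quadraticChar K t) = 2 * h 0 + (Fintype.card K - 1) * (h 1 + h (-1)) := by
  rw [← Finset.add_sum_erase _ _ (Finset.mem_univ (0 : K)), mul_add, two_mul_sum_sign]
  · rw [Finset.card_erase_of_mem (Finset.mem_univ _), Finset.card_univ,
      Nat.cast_sub Fintype.card_pos]
    simp
  · exact fun a ha => quadraticChar_dichotomy (Finset.ne_of_mem_erase ha)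
  · have := Finset.add_sum_erase _ (fun t => quadraticChar K t) (Finset.mem_univ (0 : K))
    rw [quadraticChar_sum_zero hK] at this
    simpa using this

section Tables

variable {p : ℕ} [Fact p.Prime] {F : Type*} [Field F] [Algebra (ZMod p) F] [Fintype F] {f : F → F}
  {B : F →ₗ[ZMod p] F →ₗ[ZMod p] F} {L : F →ₗ[ZMod p] F} {c₀ : F}

theorem ite_eq_ite_of_mul_eq {D : ℤ} {w : ℕ} (h : (p : ℤ) * w = D) (i : ℕ) :
    (if D = p * i then (1 : ℤ) else 0) = if i = w then 1 else 0 := by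
  have hp0 : (p : ℤ) ≠ 0 := by exact_mod_cast (Fact.out : p.Prime).ne_zero
  congr 1
  rw [← h, mul_right_inj' hp0, Nat.cast_inj]
  exact propext eq_comm

theorem hasWeightDistribution_odd {k : ℕ} (hF : Fintype.card F = p ^ (2 * k + 1)) (hp : p ≠ 2)
    (h : IsQuadratic p f B L c₀) (hB : ∀ x y, B x y = 0 → x = 0 ∨ y = 0) :
    HasWeightDistribution (puncturedCode p f)
      [(0, 1),
        ((p - 1) * p ^ (2 * k), (p ^ (2 * k + 1) - 1) * (p ^ (2 * k) + 1) * p),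
        ((p - 1) * p ^ (2 * k) + p ^ k, (p ^ (2 * k + 1) - 1) * p ^ (2 * k + 1) * (p - 1) / 2),
        ((p - 1) * p ^ (2 * k) - p ^ k, (p ^ (2 * k + 1) - 1) * p ^ (2 * k + 1) * (p - 1) / 2),
        (p ^ (2 * k + 1), p - 1)] := by
  classical
  intro i
  have hp1 : 1 ≤ p := (Fact.out : p.Prime).one_le
  have hp2 : 2 ≤ p := (Fact.out : p.Prime).two_le
  have hpm : 1 ≤ p ^ (2 * k + 1) := Nat.pos_of_ne_zero (by positivity)
  have hle : p ^ k ≤ (p - 1) * p ^ (2 * k) :=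
    (Nat.pow_le_pow_right hp1 (by omega)).trans (Nat.le_mul_of_pos_left _ (by omega))
  choose! ε hε hε' using fun (a : F) (ha : a ≠ 0) => exists_sign_weight hF hp h hB ha
  have h1 := weightCount_puncturedCode_eq (by omega) hF (injective_codewordMap hp h hB) i ε
    (fun a ha => (hε' a ha).2)
  have hG : ∀ a ≠ 0, 2 * ∑ t : ZMod p, (if (p : ℤ) ^ (2 * k + 1 + 1) - (p : ℤ) ^ (2 * k + 1) -
      ε a * quadDeviation (2 * k + 1) t = p * i then (1 : ℤ) else 0) =
      2 * (if i = (p - 1) * p ^ (2 * k) then 1 else 0) + (p - 1) *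
        ((if i = (p - 1) * p ^ (2 * k) + p ^ k then 1 else 0) +
          (if i = (p - 1) * p ^ (2 * k) - p ^ k then 1 else 0)) := by
    intro a ha
    have h3 : ¬ Even (2 * k + 1) := by simp
    have h4 : (2 * k + 1 + 1) / 2 = k + 1 := by omega
    simp only [quadDeviation, h3, if_false, h4, ZMod.card]
    rw [two_mul_sum_quadraticChar (by rwa [ZMod.ringChar_zmod_n]) (fun z =>
      if (p : ℤ) ^ (2 * k + 1 + 1) - (p : ℤ) ^ (2 * k + 1) - ε a * ((p : ℤ) ^ (k + 1) * z) = p * i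
        then (1 : ℤ) else 0), ZMod.card]
    rw [← ite_eq_ite_of_mul_eq (D := (p : ℤ) ^ (2 * k + 1 + 1) - (p : ℤ) ^ (2 * k + 1)) (p := p),
      ← ite_eq_ite_of_mul_eq (D := (p : ℤ) ^ (2 * k + 1 + 1) - (p : ℤ) ^ (2 * k + 1) +
        (p : ℤ) ^ (k + 1)) (p := p),
      ← ite_eq_ite_of_mul_eq (D := (p : ℤ) ^ (2 * k + 1 + 1) - (p : ℤ) ^ (2 * k + 1) -
        (p : ℤ) ^ (k + 1)) (p := p)]
    -- The sign only interchanges the two outer weights, so its distribution over `a` is irrelevant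
    -- here.
    · rcases hε a ha with h | h <;>
        simp only [h, mul_zero, sub_zero, one_mul, mul_one, mul_neg, neg_mul, sub_neg_eq_add] <;> ring_nf
    · push_cast [Nat.cast_sub hle, Nat.cast_sub hp1]; ring
    · push_cast [Nat.cast_sub hp1]; ring
    · push_cast [Nat.cast_sub hp1]; ring
  -- The halving in the table is exact because `p - 1` is even.
  obtain ⟨N, hN⟩ : ∃ N, (p ^ (2 * k + 1) - 1) * p ^ (2 * k + 1) * (p - 1) = 2 * N := by
    obtain ⟨l, hl⟩ := ((Fact.out : p.Prime).even_sub_one hp)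
    exact ⟨(p ^ (2 * k + 1) - 1) * p ^ (2 * k + 1) * l, by rw [hl]; ring⟩
  rw [sum_map_filter_eq, hN, Nat.mul_div_cancel_left _ two_pos]
  simp only [List.map_cons, List.map_nil, List.sum_cons, List.sum_nil]
  have hN' := congrArg (Nat.cast : ℕ → ℤ) hN
  have h5 := congrArg (2 * ·) h1
  simp only [mul_add, mul_left_comm (2 : ℤ) _ (∑ a ∈ _, _)] at h5
  rw [Finset.mul_sum, Finset.sum_congr rfl fun a ha => hG a (Finset.ne_of_mem_erase ha),
    Finset.sum_const, Finset.card_erase_of_mem (Finset.mem_univ _), Finset.card_univ, hF] at h5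
  rw [← Nat.cast_inj (R := ℤ)]
  push_cast [Nat.cast_sub hpm, Nat.cast_sub hp1, nsmul_eq_mul] at h5 hN' ⊢
  refine mul_left_cancel₀ (two_ne_zero (α := ℤ)) (h5.trans ?_)
  linear_combination ((if i = (p - 1) * p ^ (2 * k) + p ^ k then (1 : ℤ) else 0) +
    (if i = (p - 1) * p ^ (2 * k) - p ^ k then 1 else 0)) * hN'

/-- Double counting: for fixed `x ≠ 0` one has `B x x ≠ 0`, so the admissible `a` form a hyperplane.
The terms `a = 0` and `x = 0` both equal the order of `F` and cancel. -/
theorem sum_card_componentForm_eq_zero [DecidableEq F] {m : ℕ} (hF : Fintype.card F = p ^ m)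
    (hB : ∀ x y, B x y = 0 → x = 0 ∨ y = 0) :
    (p : ℤ) * ∑ a ∈ Finset.univ.erase (0 : F),
      ((Finset.univ.filter fun x => componentForm B a x x = 0).card : ℤ) = (p ^ m - 1) * p ^ m := by
  have h1 : ∑ a, ((Finset.univ.filter fun x => componentForm B a x x = 0).card : ℤ) =
      ∑ x, ((Finset.univ.filter fun a => componentForm B a x x = 0).card : ℤ) := by
    simp_rw [Finset.natCast_card_filter]
    exact Finset.sum_comm
  have h2 : ∀ x ∈ Finset.univ.erase (0 : F), (p : ℤ) *
      ((Finset.univ.filter fun a => componentForm B a x x = 0).card : ℤ) = p ^ m := by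
    intro x hx
    have hx0 := Finset.ne_of_mem_erase hx
    have hBx : B x x ≠ 0 := fun h => hx0 ((hB x x h).elim id id)
    have := card_linear_eq (Algebra.trace (ZMod p) F ∘ₗ LinearMap.mulLeft (ZMod p) (B x x))
      (fun h => hBx (trace_mul_eq_zero (p := p) fun y => LinearMap.congr_fun h y)) 0
    rw [ZMod.card, hF] at this
    rw [← Nat.cast_mul, ← Nat.cast_pow, ← this]
    congr 3
    refine Finset.filter_congr fun a _ => ?_
    rw [componentForm_apply, LinearMap.comp_apply, LinearMap.mulLeft_apply, mul_comm]
  rw [← Finset.add_sum_erase _ _ (Finset.mem_univ (0 : F)),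
    ← Finset.add_sum_erase _ _ (Finset.mem_univ (0 : F))] at h1
  have h3 : ∀ x : F, componentForm B 0 x x = 0 := fun x => by simp [componentForm_apply]
  have h4 : ∀ a : F, componentForm B a 0 0 = 0 := fun a => by simp
  simp only [h3, h4, add_right_inj] at h1
  rw [h1, Finset.mul_sum, Finset.sum_congr rfl h2, Finset.sum_const,
    Finset.card_erase_of_mem (Finset.mem_univ _), Finset.card_univ, hF, nsmul_eq_mul,
    Nat.cast_sub (Nat.pos_of_ne_zero (by have := (Fact.out : p.Prime).pos; positivity))]
  push_cast
  rfl

theorem hasWeightDistribution_even {k : ℕ} (hF : Fintype.card F = p ^ (2 * k + 2)) (hp : p ≠ 2)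
    (h : IsQuadratic p f B L c₀) (hB : ∀ x y, B x y = 0 → x = 0 ∨ y = 0) :
    HasWeightDistribution (puncturedCode p f)
      [(0, 1),
        ((p - 1) * p ^ (2 * k + 1), (p ^ (2 * k + 2) - 1) * p),
        ((p - 1) * p ^ (2 * k + 1) + (p - 1) * p ^ k, (p ^ (2 * k + 2) - 1) * p ^ (2 * k + 2) / 2),
        ((p - 1) * p ^ (2 * k + 1) - (p - 1) * p ^ k, (p ^ (2 * k + 2) - 1) * p ^ (2 * k + 2) / 2),
        ((p - 1) * p ^ (2 * k + 1) + p ^ k,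
          (p ^ (2 * k + 2) - 1) * (p - 1) * p ^ (2 * k + 2) / 2),
        ((p - 1) * p ^ (2 * k + 1) - p ^ k,
          (p ^ (2 * k + 2) - 1) * (p - 1) * p ^ (2 * k + 2) / 2),
        (p ^ (2 * k + 2), p - 1)] := by
  classical
  intro i
  have hp1 : 1 ≤ p := (Fact.out : p.Prime).one_le
  have hp2 : 2 ≤ p := (Fact.out : p.Prime).two_le
  have hpm : 1 ≤ p ^ (2 * k + 2) := Nat.pos_of_ne_zero (by positivity)
  have hle : (p - 1) * p ^ k ≤ (p - 1) * p ^ (2 * k + 1) :=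
    Nat.mul_le_mul_left _ (Nat.pow_le_pow_right hp1 (by omega))
  have hle' : p ^ k ≤ (p - 1) * p ^ (2 * k + 1) :=
    (Nat.le_mul_of_pos_left _ (by omega)).trans hle
  choose! ε hε hε' using fun (a : F) (ha : a ≠ 0) => exists_sign_weight hF hp h hB ha
  have h3 : Even (2 * k + 2) := by simp [Nat.even_add]
  have h4 : (2 * k + 2) / 2 = k + 1 := by omega
  -- The main terms of the counts at `t = 0` already exhaust the double count, so the signs,
  -- weighted by the nonzero constant `quadDeviation m 0`, sum to zero.
  have hsum : ∑ a ∈ Finset.univ.erase (0 : F), ε a = 0 := by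
    have h5 := sum_card_componentForm_eq_zero (p := p) hF hB
    rw [Finset.mul_sum, Finset.sum_congr rfl fun a ha =>
      (hε' a (Finset.ne_of_mem_erase ha)).1 0, Finset.sum_add_distrib, ← Finset.sum_mul,
      Finset.sum_const, Finset.card_erase_of_mem (Finset.mem_univ _), Finset.card_univ, hF,
      nsmul_eq_mul, Nat.cast_sub hpm] at h5
    simp only [quadDeviation, h3, if_true, h4, ZMod.card, Nat.cast_pow, Nat.cast_one,
      add_eq_left] at h5
    refine (mul_eq_zero.1 h5).resolve_right (mul_ne_zero (by positivity) ?_)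
    have : (2 : ℤ) ≤ p := by exact_mod_cast hp2
    omega
  have h1 := weightCount_puncturedCode_eq (by omega) hF (injective_codewordMap hp h hB) i ε
    (fun a ha => (hε' a ha).2)
  let G : ℤ → ℤ := fun z => if (p : ℤ) ^ (2 * k + 2 + 1) - (p : ℤ) ^ (2 * k + 2) - z = p * i
    then 1 else 0
  have hG : ∀ e : ℤ, ∑ t : ZMod p, (if (p : ℤ) ^ (2 * k + 2 + 1) - (p : ℤ) ^ (2 * k + 2) -
      e * quadDeviation (2 * k + 2) t = p * i then (1 : ℤ) else 0) =
      G (e * (p ^ (k + 1) * (p - 1))) + (p - 1) * G (e * (p ^ (k + 1) * (-1))) := by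
    intro e
    simp only [quadDeviation, h3, if_true, h4, ZMod.card]
    rw [← Finset.add_sum_erase _ _ (Finset.mem_univ (0 : ZMod p)),
      Finset.sum_congr rfl (g := fun _ => G (e * (p ^ (k + 1) * (-1))))]
    · rw [Finset.sum_const, Finset.card_erase_of_mem (Finset.mem_univ _), Finset.card_univ,
        ZMod.card, nsmul_eq_mul, Nat.cast_sub hp1]
      simp [G]
    · intro t ht
      rw [if_neg (Finset.ne_of_mem_erase ht)]
  have h5 := congrArg (2 * ·) h1
  simp only [mul_add, mul_left_comm (2 : ℤ) _ (∑ a ∈ _, _), hG] at h5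
  rw [two_mul_sum_sign _ (fun a ha => hε a (Finset.ne_of_mem_erase ha)) hsum (fun e =>
      G (e * (p ^ (k + 1) * (p - 1))) + (p - 1) * G (e * (p ^ (k + 1) * (-1)))),
    Finset.card_erase_of_mem (Finset.mem_univ _), Finset.card_univ, hF] at h5
  have g1 : G (1 * (p ^ (k + 1) * (p - 1))) =
      if i = (p - 1) * p ^ (2 * k + 1) - (p - 1) * p ^ k then 1 else 0 :=
    ite_eq_ite_of_mul_eq (by push_cast [Nat.cast_sub hle, Nat.cast_sub hp1]; ring) i
  have g2 : G (1 * (p ^ (k + 1) * (-1))) =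
      if i = (p - 1) * p ^ (2 * k + 1) + p ^ k then 1 else 0 :=
    ite_eq_ite_of_mul_eq (by push_cast [Nat.cast_sub hp1]; ring) i
  have g3 : G (-1 * (p ^ (k + 1) * (p - 1))) =
      if i = (p - 1) * p ^ (2 * k + 1) + (p - 1) * p ^ k then 1 else 0 :=
    ite_eq_ite_of_mul_eq (by push_cast [Nat.cast_sub hp1]; ring) i
  have g4 : G (-1 * (p ^ (k + 1) * (-1))) =
      if i = (p - 1) * p ^ (2 * k + 1) - p ^ k then 1 else 0 :=
    ite_eq_ite_of_mul_eq (by push_cast [Nat.cast_sub hle', Nat.cast_sub hp1]; ring) i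
  rw [g1, g2, g3, g4] at h5
  obtain ⟨N, hN⟩ : ∃ N, (p ^ (2 * k + 2) - 1) * p ^ (2 * k + 2) = 2 * N := by
    obtain ⟨l, hl⟩ := Nat.Odd.sub_odd (((Fact.out : p.Prime).odd_of_ne_two hp).pow
      (n := 2 * k + 2)) odd_one
    exact ⟨l * p ^ (2 * k + 2), by rw [hl]; ring⟩
  have hM : (p ^ (2 * k + 2) - 1) * (p - 1) * p ^ (2 * k + 2) = 2 * ((p - 1) * N) := by
    rw [mul_right_comm, hN]; ring
  rw [sum_map_filter_eq, hM, hN, Nat.mul_div_cancel_left _ two_pos,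
    Nat.mul_div_cancel_left _ two_pos]
  simp only [List.map_cons, List.map_nil, List.sum_cons, List.sum_nil]
  have hN' := congrArg (Nat.cast : ℕ → ℤ) hN
  rw [← Nat.cast_inj (R := ℤ)]
  push_cast [Nat.cast_sub hpm, Nat.cast_sub hp1] at h5 hN' ⊢
  refine mul_left_cancel₀ (two_ne_zero (α := ℤ)) (h5.trans ?_)
  linear_combination
    ((if i = (p - 1) * p ^ (2 * k + 1) - (p - 1) * p ^ k then (1 : ℤ) else 0) +
    (if i = (p - 1) * p ^ (2 * k + 1) + (p - 1) * p ^ k then 1 else 0) + (p - 1) *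
    ((if i = (p - 1) * p ^ (2 * k + 1) - p ^ k then 1 else 0) +
    (if i = (p - 1) * p ^ (2 * k + 1) + p ^ k then 1 else 0))) * hN'

theorem isLinearCode_odd {k : ℕ} (hF : Fintype.card F = p ^ (2 * k + 1)) (hp : p ≠ 2)
    (h : IsQuadratic p f B L c₀) (hB : ∀ x y, B x y = 0 → x = 0 ∨ y = 0) :
    IsLinearCode (puncturedCode p f) (p ^ (2 * k + 1)) (2 * (2 * k + 1) + 1)
      ((p - 1) * p ^ (2 * k) - p ^ k) := by
  refine ⟨hF, finrank_puncturedCode hF hp h hB, ?_⟩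
  have hp3 : 3 ≤ p := by have := (Fact.out : p.Prime).two_le; omega
  obtain ⟨q, rfl⟩ : ∃ q, p = q + 3 := ⟨p - 3, by omega⟩
  have h1 : 1 ≤ (q + 3) ^ k := Nat.one_le_pow _ _ (by omega)
  have h2 : (q + 3) ^ k ≤ (q + 3) ^ (2 * k) := Nat.pow_le_pow_right (by omega) (by omega)
  have h3 : (q + 3 - 1) * (q + 3) ^ (2 * k) = q * (q + 3) ^ (2 * k) + 2 * (q + 3) ^ (2 * k) := by
    rw [show q + 3 - 1 = q + 2 by omega]; ring
  have h4 : (q + 3) ^ (2 * k + 1) = q * (q + 3) ^ (2 * k) + 3 * (q + 3) ^ (2 * k) := by ring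
  -- The minimum nonzero weight is in the fourth row; its multiplicity must be shown positive
  -- despite the halving.
  refine isLeast_hammingDist_of_hasWeightDistribution (hasWeightDistribution_odd hF hp h hB)
    (by omega) ⟨_, .tail _ (.tail _ (.tail _ (.head _))), rfl, ?_⟩ ?_
  · refine Nat.div_pos ?_ two_pos
    have : 3 ≤ (q + 3) ^ (2 * k + 1) := Nat.le_self_pow (by omega) 3 |>.trans
      (Nat.pow_le_pow_left (by omega) _)
    calc 2 = 2 * 1 * 1 := rfl
      _ ≤ _ := Nat.mul_le_mul (Nat.mul_le_mul (by omega) (by omega)) (by omega)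
  · simp only [List.mem_cons, List.not_mem_nil, or_false, forall_eq_or_imp, forall_eq]
    refine ⟨Or.inl trivial, Or.inr ?_, Or.inr ?_, Or.inr ?_, Or.inr ?_⟩ <;> omega

theorem isLinearCode_even {k : ℕ} (hF : Fintype.card F = p ^ (2 * k + 2)) (hp : p ≠ 2)
    (h : IsQuadratic p f B L c₀) (hB : ∀ x y, B x y = 0 → x = 0 ∨ y = 0) :
    IsLinearCode (puncturedCode p f) (p ^ (2 * k + 2)) (2 * (2 * k + 2) + 1)
      ((p - 1) * (p ^ (2 * k + 1) - p ^ k)) := by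
  refine ⟨hF, finrank_puncturedCode hF hp h hB, ?_⟩
  have hp3 : 3 ≤ p := by have := (Fact.out : p.Prime).two_le; omega
  rw [Nat.mul_sub]
  obtain ⟨q, rfl⟩ : ∃ q, p = q + 3 := ⟨p - 3, by omega⟩
  have h1 : 1 ≤ (q + 3) ^ k := Nat.one_le_pow _ _ (by omega)
  have h2 : (q + 3) ^ k < (q + 3) ^ (2 * k + 1) := Nat.pow_lt_pow_right (by omega) (by omega)
  have h3 : (q + 3 - 1) * (q + 3) ^ k < (q + 3 - 1) * (q + 3) ^ (2 * k + 1) :=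
    Nat.mul_lt_mul_of_pos_left h2 (by omega)
  have h4 : (q + 3) ^ (2 * k + 2) =
      (q + 3 - 1) * (q + 3) ^ (2 * k + 1) + (q + 3) ^ (2 * k + 1) := by
    rw [show q + 3 - 1 = q + 2 by omega]; ring
  have h5 : (q + 3) ^ k ≤ (q + 3 - 1) * (q + 3) ^ k := Nat.le_mul_of_pos_left _ (by omega)
  refine isLeast_hammingDist_of_hasWeightDistribution (hasWeightDistribution_even hF hp h hB)
    (by omega) ⟨_, .tail _ (.tail _ (.tail _ (.head _))), rfl, ?_⟩ ?_
  · refine Nat.div_pos ?_ two_pos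
    have : 3 ≤ (q + 3) ^ (2 * k + 2) := Nat.le_self_pow (by omega) 3 |>.trans
      (Nat.pow_le_pow_left (by omega) _)
    calc 2 = 2 * 1 := rfl
      _ ≤ _ := Nat.mul_le_mul (by omega) (by omega)
  · simp only [List.mem_cons, List.not_mem_nil, or_false, forall_eq_or_imp, forall_eq]
    refine ⟨Or.inl trivial, Or.inr ?_, Or.inr ?_, Or.inr ?_, Or.inr ?_, Or.inr ?_, Or.inr ?_⟩ <;>
      omega

end Tables

/-! ### Nonexistence of better codes. -/

/-- Ensures that the dual dimension `p ^ m - 2 * m - 1` is not truncated. -/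
theorem two_mul_add_one_le_pow {p : ℕ} (hp : 3 ≤ p) (m : ℕ) : 2 * m + 1 ≤ p ^ m := by
  induction m with
  | zero => simp
  | succ m ih =>
    have := Nat.mul_le_mul ih hp
    rw [pow_succ]
    omega

theorem sum_triple {α M : Type*} [DecidableEq α] [AddCommMonoid M] {x y z : α} (hxy : x ≠ y)
    (hxz : x ≠ z) (hyz : y ≠ z) (g : α → M) : ∑ s ∈ {x, y, z}, g s = g x + g y + g z := by
  rw [Finset.sum_insert (by simp [hxy, hxz]), Finset.sum_pair hyz, add_assoc]

theorem sum_quadruple {α M : Type*} [DecidableEq α] [AddCommMonoid M] {x y z t : α} (hxy : x ≠ y)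
    (hxz : x ≠ z) (hxt : x ≠ t) (hyz : y ≠ z) (hyt : y ≠ t) (hzt : z ≠ t) (g : α → M) :
    ∑ s ∈ {x, y, z, t}, g s = g x + g y + g z + g t := by
  rw [Finset.sum_insert (by simp [hxy, hxz, hxt]), sum_triple hyz hyt hzt]
  simp only [add_assoc]

theorem pow_card_eq {p m : ℕ} (hp : 3 ≤ p) :
    p ^ p ^ m = p ^ (p ^ m - 2 * m - 1) * (p * (p ^ m) ^ 2) := by
  have := two_mul_add_one_le_pow hp m
  rw [← pow_mul, ← pow_succ', ← pow_add]
  congr 1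
  omega

set_option synthInstance.maxSize 1000 in
-- Four signs sum to zero modulo 3 only when two are `1` and two are `-1`.
theorem zmod_three_signs_of_add_eq_zero : ∀ α β γ δ : ZMod 3, α ≠ 0 → β ≠ 0 → γ ≠ 0 → δ ≠ 0 →
    α + β + γ + δ = 0 →
      (β = α ∧ γ = -α ∧ δ = -α) ∨ (γ = α ∧ β = -α ∧ δ = -α) ∨ (δ = α ∧ β = -α ∧ γ = -α) := by
  decide

section Optimality

variable {p : ℕ} [Fact p.Prime] {ι : Type*} [Fintype ι] {m : ℕ}

theorem three_pow_card_sub_one_eq :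
    3 ^ (3 ^ m - 1) = 3 ^ (3 ^ m - 2 * m - 1) * (3 ^ m) ^ 2 := by
  have := two_mul_add_one_le_pow le_rfl m
  rw [← pow_mul, ← pow_add]
  congr 1
  omega

/-- Used twice: for optimality, and on the dual code itself, where it supplies a word of weight 4
without an explicit construction. -/
theorem exists_hammingDist_lt_five (hp : 5 ≤ p) (hm : 0 < m) (hι : Fintype.card ι = p ^ m)
    (C : Submodule (ZMod p) (ι → ZMod p))
    (hC : Module.finrank (ZMod p) C = p ^ m - 2 * m - 1) :
    ∃ x ∈ C, ∃ y ∈ C, x ≠ y ∧ hammingDist x y < 5 := by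
  classical
  by_contra! h
  have h1 := pow_finrank_mul_sum_choose_le C 2 fun x hx y hy hxy => h x hx y hy hxy
  rw [hC, hι, ZMod.card, pow_card_eq (by omega)] at h1
  exact (Nat.mul_lt_mul_of_pos_left (mul_lt_sum_range_three_choose hp
    (hp.trans (Nat.le_self_pow hm.ne' p))) (by positivity)).not_ge h1

theorem nine_le_three_pow (hm : 1 < m) : 9 ≤ 3 ^ m :=
  Nat.pow_le_pow_right (n := 3) (by norm_num) hm

theorem exists_hammingDist_lt_six (hm : 1 < m) (hι : Fintype.card ι = 3 ^ m)
    (C : Submodule (ZMod 3) (ι → ZMod 3))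
    (hC : Module.finrank (ZMod 3) C = 3 ^ m - 2 * m - 1) :
    ∃ x ∈ C, ∃ y ∈ C, x ≠ y ∧ hammingDist x y < 6 := by
  classical
  by_contra! h
  obtain ⟨i₀⟩ : Nonempty ι := Fintype.card_pos_iff.1 (hι ▸ by positivity)
  have h1 := pow_finrank_mul_sum_choose_le_of_puncture i₀ C 2
    fun x hx y hy hxy => h x hx y hy hxy
  rw [hC, hι, ZMod.card, three_pow_card_sub_one_eq] at h1
  exact (Nat.mul_lt_mul_of_pos_left (sq_lt_sum_range_three_choose (nine_le_three_pow hm))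
    (by positivity)).not_ge h1

theorem isLeast_hammingDist_of_le_of_lt {K : Type*} [Field K] [DecidableEq K]
    {C : Submodule K (ι → K)} {d : ℕ} (h : ∀ v ∈ C, v ≠ 0 → d ≤ hammingNorm v)
    (h' : ∃ x ∈ C, ∃ y ∈ C, x ≠ y ∧ hammingDist x y < d + 1) :
    IsLeast {e : ℕ | ∃ x ∈ C, ∃ y ∈ C, x ≠ y ∧ hammingDist x y = e} d := by
  obtain ⟨x, hx, y, hy, hxy, hlt⟩ := h'
  rw [hammingDist_eq_hammingNorm, neg_add_eq_sub] at hlt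
  have h1 : y - x ∈ C := C.sub_mem hy hx
  have h2 : y - x ≠ 0 := sub_ne_zero.2 hxy.symm
  exact isLeast_hammingDist ⟨y - x, h1, h2, (Nat.lt_succ_iff.1 hlt).antisymm (h _ h1 h2)⟩ h

end Optimality

/-! ### Low-weight words of the dual code. -/

theorem sum_smul_eq_sum_of_subset {p : ℕ} {F : Type*} [Fintype F] {M : Type*}
    [AddCommGroup M] [Module (ZMod p) M] {v : F → ZMod p}
    {S : Finset F} (hS : ∀ x, v x ≠ 0 → x ∈ S) (g : F → M) :
    ∑ x ∈ S, v x • g x = ∑ x, v x • g x := by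
  refine Finset.sum_subset (Finset.subset_univ S) fun x _ hx => ?_
  rw [not_not.1 fun h => hx (hS x h), zero_smul]

section Dual

variable {p : ℕ} [Fact p.Prime] {F : Type*} [Field F] [Algebra (ZMod p) F] [Fintype F] {f : F → F}
  {B : F →ₗ[ZMod p] F →ₗ[ZMod p] F} {L : F →ₗ[ZMod p] F} {c₀ : F}

theorem sums_eq_zero_of_mem_dualCode {v : F → ZMod p} (hv : v ∈ dualCode (puncturedCode p f)) :
    ∑ x, v x = 0 ∧ ∑ x, v x • x = 0 ∧ ∑ x, v x • f x = 0 := by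
  have h : ∀ (a b : F) (c : ZMod p),
      ∑ x, v x * (Algebra.trace (ZMod p) F (a * f x + b * x) + c) = 0 :=
    fun a b c => hv _ ⟨a, b, c, rfl⟩
  refine ⟨by simpa using h 0 0 1, ?_, ?_⟩
  · refine trace_mul_eq_zero (p := p) fun b => ?_
    have := h 0 b 0
    simp only [zero_mul, zero_add, add_zero] at this
    rw [← this, Finset.sum_mul, map_sum]
    refine Finset.sum_congr rfl fun x _ => ?_
    rw [smul_mul_assoc, map_smul, smul_eq_mul, mul_comm x]
  · refine trace_mul_eq_zero (p := p) fun a => ?_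
    have := h a 0 0
    simp only [zero_mul, add_zero] at this
    rw [← this, Finset.sum_mul, map_sum]
    refine Finset.sum_congr rfl fun x _ => ?_
    rw [smul_mul_assoc, map_smul, smul_eq_mul, mul_comm (f x)]

theorem IsQuadratic.eq_zero_of_three_points (h : IsQuadratic p f B L c₀)
    (hB : ∀ x y, B x y = 0 → x = 0 ∨ y = 0) {x y z : F} (hxy : x ≠ y) (hxz : x ≠ z) (hyz : y ≠ z)
    {α β γ : ZMod p} (h0 : α + β + γ = 0) (h1 : α • x + β • y + γ • z = 0)
    (h2 : α • f x + β • f y + γ • f z = 0) : α = 0 ∧ β = 0 ∧ γ = 0 := by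
  obtain rfl : γ = -(α + β) := by linear_combination h0
  obtain ⟨u, rfl⟩ : ∃ u, x = z + u := ⟨x - z, by ring⟩
  obtain ⟨w, rfl⟩ : ∃ w, y = z + w := ⟨y - z, by ring⟩
  have e1 : α • u + β • w = 0 := by
    rw [← h1]
    module
  have e2 : α • B u u + β • B w w = 0 := by
    have eL : α • L u + β • L w = 0 := by rw [← map_smul, ← map_smul, ← map_add, e1, map_zero]
    have eB : α • B z u + β • B z w = 0 := by rw [← map_smul, ← map_smul, ← map_add, e1, map_zero]
    have h2' : α • f (z + u) + β • f (z + w) + (-(α + β)) • f z =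
        (α • B u u + β • B w w) + (2 : ZMod p) • (α • B z u + β • B z w) +
          (α • L u + β • L w) := by
      simp only [h.eq, map_add, LinearMap.add_apply, h.symm u z, h.symm w z]
      module
    rw [h2', eL, eB] at h2
    simpa using h2
  -- Evaluate the quadratic form at both sides of `α u = -β w`; with `e2` this leaves `β (α + β) B w
  -- w = 0`.
  have e3 : (α * α) • B u u = (β * β) • B w w := by
    have := congrArg (fun t => B t t) (eq_neg_of_add_eq_zero_left e1)
    simpa [smul_smul] using this
  have e4 : (β * (α + β)) • B w w = 0 := by
    have : (β * (α + β)) • B w w = α • (α • B u u + β • B w w) -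
        ((α * α) • B u u - (β * β) • B w w) := by module
    rw [this, e2, e3]
    simp
  have hw : w ≠ 0 := by rintro rfl; simp at hyz
  have hu : u ≠ 0 := by rintro rfl; simp at hxz
  have hBw : B w w ≠ 0 := fun h => hw ((hB w w h).elim id id)
  rcases mul_eq_zero.1 ((smul_eq_zero.1 e4).resolve_right hBw) with hβ | hαβ
  · subst hβ
    have : α = 0 := (smul_eq_zero.1 (by simpa using e1)).resolve_right hu
    simp [this]
  · obtain rfl : β = -α := by linear_combination hαβ
    have : α = 0 := by
      have h3 : α • (u - w) = 0 := by rw [← e1]; module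
      refine (smul_eq_zero.1 h3).resolve_right fun h4 => hxy ?_
      rw [sub_eq_zero.1 h4]
    simp [this]

theorem four_le_hammingNorm_of_mem_dualCode (hp : 3 ≤ Fintype.card F) (h : IsQuadratic p f B L c₀)
    (hB : ∀ x y, B x y = 0 → x = 0 ∨ y = 0) {v : F → ZMod p}
    (hv : v ∈ dualCode (puncturedCode p f)) (hv0 : v ≠ 0) : 4 ≤ hammingNorm v := by
  classical
  by_contra! hlt
  -- Padding the support to exactly three points treats weights 1, 2 and 3 at once.
  obtain ⟨S, hS, hS3⟩ := Finset.exists_superset_card_eq (Nat.lt_succ_iff.1 hlt) hp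
  have hS' : ∀ x, v x ≠ 0 → x ∈ S := fun x hx => hS (by simpa using hx)
  obtain ⟨h0, h1, h2⟩ := sums_eq_zero_of_mem_dualCode hv
  have h0' : ∑ x, v x • (1 : ZMod p) = 0 := by simpa using h0
  rw [← sum_smul_eq_sum_of_subset hS'] at h0' h1 h2
  obtain ⟨x, y, z, hxy, hxz, hyz, rfl⟩ := Finset.card_eq_three.1 hS3
  rw [sum_triple hxy hxz hyz] at h0' h1 h2
  simp only [smul_eq_mul, mul_one] at h0'
  obtain ⟨hα, hβ, hγ⟩ := h.eq_zero_of_three_points hB hxy hxz hyz h0' h1 h2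
  apply hv0
  ext t
  by_contra ht
  have := hS' t ht
  simp only [Finset.mem_insert, Finset.mem_singleton] at this
  rcases this with rfl | rfl | rfl
  · exact ht hα
  · exact ht hβ
  · exact ht hγ

/-- With `d = x - z = t - y`, the increments of `f` by `d` at `z` and at `y` agree. -/
theorem IsPerfectNonlinear.eq_of_add_eq_add (hf : IsPerfectNonlinear f) {x y z t : F}
    (hxz : x ≠ z) (h1 : x + y = z + t) (h2 : f x + f y = f z + f t) : z = y := by
  refine hf.eq_of_sub_eq (sub_ne_zero.2 hxz) ?_
  rw [show z + (x - z) = x by ring, show y + (x - z) = t by linear_combination h1]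
  linear_combination h2

omit [Fintype F] in
theorem add_eq_add_of_sum_smul_eq_zero {M : Type*} [AddCommGroup M] [Module (ZMod p) M] {α : ZMod p}
    (hα : α ≠ 0) {x y z t : M} (h : α • x + α • y + (-α) • z + (-α) • t = 0) :
    x + y = z + t := by
  have h1 : α • (x + y - (z + t)) = 0 := by rw [← h]; module
  have h2 : α⁻¹ • α • (x + y - (z + t)) = 0 := by rw [h1, smul_zero]
  rw [inv_smul_smul₀ hα] at h2
  exact sub_eq_zero.1 h2

theorem five_le_hammingNorm_of_mem_dualCode [Algebra (ZMod 3) F] {B : F →ₗ[ZMod 3] F →ₗ[ZMod 3] F}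
    {L : F →ₗ[ZMod 3] F}
    (hp : 3 ≤ Fintype.card F) (h : IsQuadratic 3 f B L c₀)
    (hB : ∀ x y, B x y = 0 → x = 0 ∨ y = 0) (hf : IsPerfectNonlinear f) {v : F → ZMod 3}
    (hv : v ∈ dualCode (puncturedCode 3 f)) (hv0 : v ≠ 0) : 5 ≤ hammingNorm v := by
  classical
  refine Nat.lt_of_le_of_ne (four_le_hammingNorm_of_mem_dualCode hp h hB hv hv0) fun h4 => ?_
  obtain ⟨x, T, hxT, hT, hT3⟩ := Finset.card_eq_succ.1 h4.symm
  obtain ⟨y, z, t, hyz, hyt, hzt, rfl⟩ := Finset.card_eq_three.1 hT3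
  simp only [Finset.mem_insert, Finset.mem_singleton, not_or] at hxT
  obtain ⟨hxy, hxz, hxt⟩ := hxT
  have hS : ∀ s, v s ≠ 0 ↔ s ∈ ({x, y, z, t} : Finset F) := fun s => by simp [hT]
  obtain ⟨h0, h1, h2⟩ := sums_eq_zero_of_mem_dualCode hv
  have h0' : ∑ x, v x • (1 : ZMod 3) = 0 := by simpa using h0
  rw [← sum_smul_eq_sum_of_subset fun s => (hS s).1] at h0' h1 h2
  rw [sum_quadruple hxy hxz hxt hyz hyt hzt] at h0' h1 h2
  simp only [smul_eq_mul, mul_one] at h0'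
  have hvx : v x ≠ 0 := (hS x).2 (by simp)
  rcases zmod_three_signs_of_add_eq_zero _ _ _ _ hvx ((hS y).2 (by simp)) ((hS z).2 (by simp))
    ((hS t).2 (by simp)) h0' with
    ⟨e1, e2, e3⟩ | ⟨e1, e2, e3⟩ | ⟨e1, e2, e3⟩ <;> rw [e1, e2, e3] at h1 h2
  · exact hyz.symm (hf.eq_of_add_eq_add hxz (add_eq_add_of_sum_smul_eq_zero hvx h1)
      (add_eq_add_of_sum_smul_eq_zero hvx h2))
  -- Bring the two points carrying the coefficient `v x` to the front.
  · rw [add_right_comm (v x • _)] at h1 h2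
    exact hyz (hf.eq_of_add_eq_add hxy (add_eq_add_of_sum_smul_eq_zero hvx h1)
      (add_eq_add_of_sum_smul_eq_zero hvx h2))
  · rw [add_right_comm, add_right_comm (v x • _)] at h1 h2
    exact hyt (hf.eq_of_add_eq_add hxy (add_eq_add_of_sum_smul_eq_zero hvx h1)
      (add_eq_add_of_sum_smul_eq_zero hvx h2))

theorem finrank_dualCode_puncturedCode {m : ℕ} (hF : Fintype.card F = p ^ m) (hp : p ≠ 2)
    (h : IsQuadratic p f B L c₀) (hB : ∀ x y, B x y = 0 → x = 0 ∨ y = 0) :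
    Module.finrank (ZMod p) (dualCode (puncturedCode p f)) = p ^ m - 2 * m - 1 := by
  rw [finrank_dualCode, finrank_puncturedCode hF hp h hB, hF, Nat.sub_sub]

end Dual

/-! ### The main theorem. -/

theorem corollary1 (p m : ℕ) [Fact p.Prime] (hp : p ≠ 2) (hm : 0 < m)
    {F : Type*} [Field F] [Fintype F] [Algebra (ZMod p) F] (hF : Fintype.card F = p ^ m)
    (f : F → F) (hf : IsPNDO p f) :
    (Odd m →
      IsLinearCode (puncturedCode p f) (p ^ m) (2 * m + 1)
          ((p - 1) * p ^ (m - 1) - p ^ ((m - 1) / 2)) ∧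
        HasWeightDistribution (puncturedCode p f)
          [(0, 1),
            ((p - 1) * p ^ (m - 1), (p ^ m - 1) * (p ^ (m - 1) + 1) * p),
            ((p - 1) * p ^ (m - 1) + p ^ ((m - 1) / 2), (p ^ m - 1) * p ^ m * (p - 1) / 2),
            ((p - 1) * p ^ (m - 1) - p ^ ((m - 1) / 2), (p ^ m - 1) * p ^ m * (p - 1) / 2),
            (p ^ m, p - 1)]) ∧
    (Even m →
      IsLinearCode (puncturedCode p f) (p ^ m) (2 * m + 1)
          ((p - 1) * (p ^ (m - 1) - p ^ ((m - 2) / 2))) ∧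
        HasWeightDistribution (puncturedCode p f)
          [(0, 1),
            ((p - 1) * p ^ (m - 1), (p ^ m - 1) * p),
            ((p - 1) * p ^ (m - 1) + (p - 1) * p ^ ((m - 2) / 2), (p ^ m - 1) * p ^ m / 2),
            ((p - 1) * p ^ (m - 1) - (p - 1) * p ^ ((m - 2) / 2), (p ^ m - 1) * p ^ m / 2),
            ((p - 1) * p ^ (m - 1) + p ^ ((m - 2) / 2), (p ^ m - 1) * (p - 1) * p ^ m / 2),
            ((p - 1) * p ^ (m - 1) - p ^ ((m - 2) / 2), (p ^ m - 1) * (p - 1) * p ^ m / 2),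
            (p ^ m, p - 1)]) ∧
    (p = 3 → 1 < m →
      IsLinearCode (dualCode (puncturedCode p f)) (3 ^ m) (3 ^ m - 2 * m - 1) 5 ∧
        DistanceOptimal (ZMod p) (3 ^ m) (3 ^ m - 2 * m - 1) 5 ∧
        elRouayhebBound 3 (3 ^ m) (5 + 1) < (3 : ℚ) ^ (3 ^ m - 2 * m - 1)) ∧
    (3 < p →
      IsLinearCode (dualCode (puncturedCode p f)) (p ^ m) (p ^ m - 2 * m - 1) 4 ∧
        DistanceOptimal (ZMod p) (p ^ m) (p ^ m - 2 * m - 1) 4 ∧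
        spherePackingBound p (p ^ m) (4 + 1) < (p : ℚ) ^ (p ^ m - 2 * m - 1)) := by
  have hp3 : 3 ≤ p := by have := (Fact.out : p.Prime).two_le; omega
  obtain ⟨B, L, c₀, h⟩ := hf.2.exists_isQuadratic hp
  have hB : ∀ x y, B x y = 0 → x = 0 ∨ y = 0 := fun x y => h.eq_zero_or_eq_zero hf.1
  have hF3 : 3 ≤ Fintype.card F := hF ▸ hp3.trans (Nat.le_self_pow hm.ne' p)
  refine ⟨?_, ?_, ?_, ?_⟩
  · rintro ⟨k, rfl⟩
    rw [show 2 * k + 1 - 1 = 2 * k by omega, show 2 * k / 2 = k by omega]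
    exact ⟨isLinearCode_odd hF hp h hB, hasWeightDistribution_odd hF hp h hB⟩
  · intro hme
    obtain ⟨k, rfl⟩ : ∃ k, m = 2 * k + 2 := by
      obtain ⟨j, rfl⟩ := hme
      exact ⟨j - 1, by omega⟩
    rw [show 2 * k + 2 - 1 = 2 * k + 1 by omega, show (2 * k + 2 - 2) / 2 = k by omega]
    exact ⟨isLinearCode_even hF hp h hB, hasWeightDistribution_even hF hp h hB⟩
  · rintro rfl hm1
    refine ⟨⟨hF, finrank_dualCode_puncturedCode hF hp h hB, ?_⟩, ?_, ?_⟩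
    · exact isLeast_hammingDist_of_le_of_lt
        (fun v hv hv0 => five_le_hammingNorm_of_mem_dualCode hF3 h hB hf.1 hv hv0)
        (exists_hammingDist_lt_six hm1 hF _ (finrank_dualCode_puncturedCode hF hp h hB))
    · rintro ⟨C, -, hC, hd⟩
      obtain ⟨x, hx, y, hy, hxy, hlt⟩ := exists_hammingDist_lt_six hm1 (by simp) C hC
      exact (hd.2 ⟨x, hx, y, hy, hxy, rfl⟩).not_gt hlt
    · exact elRouayhebBound_lt (nine_le_three_pow hm1) three_pow_card_sub_one_eq
  · intro hp4
    have hp5 : 5 ≤ p := by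
      rcases (Nat.succ_le_of_lt hp4).eq_or_lt with h4 | h4
      · exact absurd (Fact.out : p.Prime) (h4 ▸ by norm_num)
      · exact h4
    refine ⟨⟨hF, finrank_dualCode_puncturedCode hF hp h hB, ?_⟩, ?_, ?_⟩
    · exact isLeast_hammingDist_of_le_of_lt
        (fun v hv hv0 => four_le_hammingNorm_of_mem_dualCode hF3 h hB hv hv0)
        (exists_hammingDist_lt_five hp5 hm hF _ (finrank_dualCode_puncturedCode hF hp h hB))
    · rintro ⟨C, -, hC, hd⟩
      obtain ⟨x, hx, y, hy, hxy, hlt⟩ := exists_hammingDist_lt_five hp5 hm (by simp) C hC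
      exact (hd.2 ⟨x, hx, y, hy, hxy, rfl⟩).not_gt hlt
    · exact spherePackingBound_lt hp5 (pow_card_eq hp3) (hp5.trans (Nat.le_self_pow hm.ne' p))
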